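/- Let $N$ be a natural number. Let ${\boldsymbol s}=(s_1,\dots,s_N)\in\mathbb Z^N$, and let ${\boldsymbol t}=(t_{\alpha,k})$, $\bar{\boldsymbol t}=(\bar t_{\alpha,k})$ ($1\le\alpha\le N$, $k\ge1$) be two infinite families of times. Functions of the times are understood as formal power series, i.e. elements of $R=\mathbb C[[{\boldsymbol t},\bar{\boldsymbol t}]]$. For $\alpha=1,\dots,N$ put $\xi({\boldsymbol t}_\alpha,z)=\sum_{k\ge1}t_{\alpha,k}z^k$, and for $f({\boldsymbol t},\bar{\boldsymbol t})\in R$ let $f({\boldsymbol t}\pm[z^{-1}]_\gamma,\bar{\boldsymbol t})$ be the result of replacing $t_{\alpha,j}$ by $t_{\alpha,j}\pm\delta_{\alpha\gamma}\frac{z^{-j}}{j}$; similarly for $\bar{\boldsymbol t}$. Let ${\boldsymbol s}\pm[1]_\alpha$ be ${\boldsymbol s}$ with $s_\alpha$ replaced by $s_\alpha\pm1$. Let $$\Psi_{\alpha\beta}({\boldsymbol s},{\boldsymbol t},\bar{\boldsymbol t};z)=\sum_{j\ge0}w_{j,\alpha\beta}({\boldsymbol s},{\boldsymbol t},\bar{\boldsymbol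 t})\,z^{s_\beta-j}e^{\xi({\boldsymbol t}_\beta,z)},\qquad \Psi^*_{\alpha\beta}({\boldsymbol s},{\boldsymbol t},\bar{\boldsymbol t};z)=\sum_{j\ge0}w^*_{j,\alpha\beta}({\boldsymbol s},{\boldsymbol t},\bar{\boldsymbol t})\,z^{-s_\alpha-j}e^{-\xi({\boldsymbol t}_\alpha,z)},$$ $$\bar\Psi_{\alpha\beta}({\boldsymbol s},{\boldsymbol t},\bar{\boldsymbol t};z)=\sum_{j\ge0}\bar w_{j,\alpha\beta}({\boldsymbol s},{\boldsymbol t},\bar{\boldsymbol t})\,z^{s_\beta+j}e^{\xi(\bar{\boldsymbol t}_\beta,z^{-1})},\qquad \bar\Psi^*_{\alpha\beta}({\boldsymbol s},{\boldsymbol t},\bar{\boldsymbol t};z)=\sum_{j\ge0}\bar w^*_{j,\alpha\beta}({\boldsymbol s},{\boldsymbol t},\bar{\boldsymbol t})\,z^{-s_\alpha+j}e^{-\xi(\bar{\boldsymbol t}_\alpha,z^{-1})}$$ be wave functions and adjoint wave functions, where $w_j,w_j^*,\bar w_j,\bar w_j^*$ are $N\times N$ matrices over $R$ depending on ${\boldsymbol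 s}\in\mathbb Z^N$, with $w_0=w_0^*=1_N$ and with $\bar w_0$, $\bar w_0^*$ invertible over $R$. Assume the bilinear identity $$\sum_{\gamma=1}^N\oint_{C_\infty}\Psi_{\alpha\gamma}({\boldsymbol s},{\boldsymbol t},\bar{\boldsymbol t};z)\,\Psi^*_{\gamma\beta}({\boldsymbol s}',{\boldsymbol t}',\bar{\boldsymbol t}';z)\,dz=\sum_{\gamma=1}^N\oint_{C_\infty}\bar\Psi_{\alpha\gamma}({\boldsymbol s},{\boldsymbol t},\bar{\boldsymbol t};z^{-1})\,\bar\Psi^*_{\gamma\beta}({\boldsymbol s}',{\boldsymbol t}',\bar{\boldsymbol t}';z^{-1})\,z^{-2}dz$$ for all $\alpha,\beta$, all ${\boldsymbol s},{\boldsymbol s}'\in\mathbb Z^N$, and identically in the independent families of times ${\boldsymbol t},\bar{\boldsymbol t},{\boldsymbol t}',\bar{\boldsymbol t}'$. Here the integrands are expanded at $z=\infty$, so that the coefficient of each monomial in the times is a Laurent series in $z^{-1}$, and $\oint_{C_\infty}$ is the formal residue $\sum_k a_kz^k\,dz\mapsto a_{-1}$. Then there exists an $N\times N$ matrix-valued function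 $\bigl(\tau_{\alpha\beta}({\boldsymbol s},{\boldsymbol t},\bar{\boldsymbol t})\bigr)_{\alpha,\beta=1,\dots,N}$ with entries in $R$ for every ${\boldsymbol s}\in\mathbb Z^N$, such that all diagonal elements coincide, $\tau_{\alpha\alpha}({\boldsymbol s},{\boldsymbol t},\bar{\boldsymbol t})=:\tau({\boldsymbol s},{\boldsymbol t},\bar{\boldsymbol t})$, such that $\tau({\boldsymbol s},{\boldsymbol t},\bar{\boldsymbol t})$ is invertible in $R$ for every ${\boldsymbol s}$, and such that for all ${\boldsymbol s}$, $\alpha$, $\beta$ $$\Psi_{\alpha\beta}({\boldsymbol s},{\boldsymbol t},\bar{\boldsymbol t};z)=z^{s_\beta+\delta_{\alpha\beta}-1}e^{\xi({\boldsymbol t}_\beta,z)}\frac{\tau_{\alpha\beta}({\boldsymbol s},{\boldsymbol t}-[z^{-1}]_\beta,\bar{\boldsymbol t})}{\tau({\boldsymbol s},{\boldsymbol t},\bar{\boldsymbol t})},$$ $$\Psi^*_{\alpha\beta}({\boldsymbol s},{\boldsymbol t},\bar{\boldsymbol t};z)=(-1)^{\delta_{\alpha\beta}-1}z^{-s_\alpha+\delta_{\alpha\beta}-1}e^{-\xi({\boldsymbol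 t}_\alpha,z)}\frac{\tau_{\alpha\beta}({\boldsymbol s},{\boldsymbol t}+[z^{-1}]_\alpha,\bar{\boldsymbol t})}{\tau({\boldsymbol s},{\boldsymbol t},\bar{\boldsymbol t})},$$ $$\bar\Psi_{\alpha\beta}({\boldsymbol s},{\boldsymbol t},\bar{\boldsymbol t};z^{-1})=(-1)^{\delta_{\alpha\beta}-1}z^{-s_\beta}e^{\xi(\bar{\boldsymbol t}_\beta,z)}\frac{\tau_{\alpha\beta}({\boldsymbol s}+[1]_\beta,{\boldsymbol t},\bar{\boldsymbol t}-[z^{-1}]_\beta)}{\tau({\boldsymbol s},{\boldsymbol t},\bar{\boldsymbol t})},$$ $$\bar\Psi^*_{\alpha\beta}({\boldsymbol s},{\boldsymbol t},\bar{\boldsymbol t};z^{-1})=z^{s_\alpha}e^{-\xi(\bar{\boldsymbol t}_\alpha,z)}\frac{\tau_{\alpha\beta}({\boldsymbol s}-[1]_\alpha,{\boldsymbol t},\bar{\boldsymbol t}+[z^{-1}]_\alpha)}{\tau({\boldsymbol s},{\boldsymbol t},\bar{\boldsymbol t})}.$$ -/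

import Mathlib

namespace MultiToda

open MvPowerSeries

/-- The continuous times of the `N`-component Toda lattice hierarchy. The variable `Sum.inl (α, k)`
is `t_{α,k}` and `Sum.inr (α, k)` is `t̄_{α,k}` (`1 ≤ α ≤ N`, `k ≥ 1`). -/
abbrev TimeVar (N : ℕ) : Type := (Fin N × ℕ+) ⊕ (Fin N × ℕ+)

/-- Functions of the times `t`, `t̄`: formal power series over `ℂ` in all the times. -/
abbrev TimeFun (N : ℕ) : Type := MvPowerSeries (TimeVar N) ℂ

/-- Formal series in variables `σ` and in the spectral parameter `z`. The coefficient of each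
monomial in the variables of `σ` is a Laurent series at `z = ∞`, that is, an element of
`ℂ((z⁻¹))`; the variable of `LaurentSeries ℂ` is the local parameter `z⁻¹`. -/
abbrev ZSeries (σ : Type) : Type := MvPowerSeries σ (LaurentSeries ℂ)

/-- The power `z ^ n` for `n : ℤ`. -/
noncomputable def zPow {σ : Type} (n : ℤ) : ZSeries σ :=
  C (HahnSeries.single (-n) (1 : ℂ))

/-- A series not depending on `z`, regarded as a series in `z`. -/
noncomputable def constZ {σ : Type} (f : MvPowerSeries σ ℂ) : ZSeries σ :=
  MvPowerSeries.map (HahnSeries.C : ℂ →+* LaurentSeries ℂ) f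

/-- The series `∑_{j ≥ 0} a_j z^{-j}`. -/
noncomputable def sumNegPow {σ : Type} (a : ℕ → MvPowerSeries σ ℂ) : ZSeries σ :=
  fun m => HahnSeries.ofPowerSeries ℤ ℂ (PowerSeries.mk fun j => coeff m (a j))

/-- The formal residue `res (∑ a_k z^k dz) = a_{-1}`, i.e. the integral over the contour around
infinity divided by `2πi` (with the orientation for which `z⁻¹ dz` gives `1`). -/
noncomputable def res {σ : Type} (F : ZSeries σ) : MvPowerSeries σ ℂ :=
  fun m => HahnSeries.coeff (coeff m F) 1

/-- `ξ(x, z) = ∑_{k ≥ 1} x_k z^k` for a sequence of variables `x_k`; the sum is taken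
coefficientwise. -/
noncomputable def xi {σ : Type} (x : ℕ+ → σ) : ZSeries σ :=
  fun m => ∑ᶠ k : ℕ+, coeff m (X (x k) * zPow ((k : ℕ) : ℤ) : ZSeries σ)

theorem constantCoeff_xi {σ : Type} (x : ℕ+ → σ) : constantCoeff (xi x) = 0 := by
  change (∑ᶠ k : ℕ+, coeff (0 : σ →₀ ℕ) (X (x k) * zPow ((k : ℕ) : ℤ) : ZSeries σ)) = 0
  simp

/-- The formal exponential `e^F = ∑_{n ≥ 0} F^n / n!` (of a series without constant term). -/
noncomputable def expZ {σ : Type} (F : ZSeries σ) : ZSeries σ :=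
  (PowerSeries.exp ℂ).subst F

/-- `ξ(t_α, z) = ∑_{k ≥ 1} t_{α,k} z^k`. -/
noncomputable def xiT {N : ℕ} (α : Fin N) : ZSeries (TimeVar N) :=
  xi fun k => Sum.inl (α, k)

/-- `ξ(t̄_α, z) = ∑_{k ≥ 1} t̄_{α,k} z^k`. -/
noncomputable def xiTbar {N : ℕ} (α : Fin N) : ZSeries (TimeVar N) :=
  xi fun k => Sum.inr (α, k)

/-- The substitution `t_{α,j} ↦ t_{α,j} + ε δ_{αγ} z^{-j} / j`, `t̄_{α,j} ↦ t̄_{α,j}`; the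
additional variable `none` stands for `z⁻¹`. -/
noncomputable def shiftT {N : ℕ} (ε : ℂ) (γ : Fin N) :
    TimeVar N → MvPowerSeries (Option (TimeVar N)) ℂ
  | Sum.inl (α, j) => X (some (Sum.inl (α, j))) +
      if α = γ then C (ε / ((j : ℕ) : ℂ)) * X none ^ (j : ℕ) else 0
  | Sum.inr v => X (some (Sum.inr v))

/-- The substitution `t̄_{α,j} ↦ t̄_{α,j} + ε δ_{αγ} z^{-j} / j`, `t_{α,j} ↦ t_{α,j}`; the
additional variable `none` stands for `z⁻¹`. -/
noncomputable def shiftTbar {N : ℕ} (ε : ℂ) (γ : Fin N) :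
    TimeVar N → MvPowerSeries (Option (TimeVar N)) ℂ
  | Sum.inl v => X (some (Sum.inl v))
  | Sum.inr (α, j) => X (some (Sum.inr (α, j))) +
      if α = γ then C (ε / ((j : ℕ) : ℂ)) * X none ^ (j : ℕ) else 0

/-- A power series in the variables `σ` and in `z⁻¹` (the variable `none`), regarded as an element
of `ZSeries σ`. -/
noncomputable def collectZ {σ : Type} (f : MvPowerSeries (Option σ) ℂ) : ZSeries σ :=
  sumNegPow fun j m => coeff (m.mapDomain some + Finsupp.single none j) f

/-- `f(t + ε [z⁻¹]_γ, t̄)`. -/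
noncomputable def miwaT {N : ℕ} (ε : ℂ) (γ : Fin N) (f : TimeFun N) : ZSeries (TimeVar N) :=
  collectZ (f.subst (shiftT ε γ))

/-- `f(t, t̄ + ε [z⁻¹]_γ)`. -/
noncomputable def miwaTbar {N : ℕ} (ε : ℂ) (γ : Fin N) (f : TimeFun N) : ZSeries (TimeVar N) :=
  collectZ (f.subst (shiftTbar ε γ))

theorem finite_coeff_X_ne {σ τ : Type} {x : σ → τ} (hx : Function.Injective x) (d : τ →₀ ℕ) :
    {v | coeff d (X (x v) : MvPowerSeries τ ℂ) ≠ 0}.Finite := by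
  classical
  apply Set.Subsingleton.finite
  intro a ha b hb
  simp only [Set.mem_ofPred_eq, coeff_X, ne_eq, ite_eq_right_iff, one_ne_zero, imp_false,
    not_not] at ha hb
  exact hx (Finsupp.single_left_injective one_ne_zero (ha.symm.trans hb))

theorem hasSubst_shiftT {N : ℕ} (ε : ℂ) (γ : Fin N) : HasSubst (shiftT ε γ) where
  const_coeff v := by
    rcases v with ⟨α, j⟩ | v
    · by_cases h : α = γ <;> simp [shiftT, h]
    · simp [shiftT]
  coeff_zero d := by
    classical
    have h1 := finite_coeff_X_ne (Option.some_injective (TimeVar N)) d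
    refine (h1.union (Set.finite_range
      fun p : Fin N × Fin (d none + 1) => (Sum.inl (p.1, (p.2 : ℕ).toPNat') : TimeVar N))).subset ?_
    rintro (⟨α, j⟩ | v) hv
    · by_contra hcon
      simp only [Set.mem_union, Set.mem_ofPred_eq, not_or, not_not, Set.mem_range, Prod.exists,
        not_exists] at hcon
      apply hv
      have hj : d ≠ Finsupp.single none (j : ℕ) := by
        intro hd
        have : d none = j := by rw [hd]; simp
        refine hcon.2 α ⟨j, by omega⟩ ?_
        simp
      by_cases h : α = γ
      · simp [shiftT, h, coeff_C_mul, coeff_X_pow, hj]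
        simpa [h] using hcon.1
      · simp [shiftT, h]
        simpa using hcon.1
    · exact Or.inl hv

theorem hasSubst_shiftTbar {N : ℕ} (ε : ℂ) (γ : Fin N) : HasSubst (shiftTbar ε γ) where
  const_coeff v := by
    rcases v with v | ⟨α, j⟩
    · simp [shiftTbar]
    · by_cases h : α = γ <;> simp [shiftTbar, h]
  coeff_zero d := by
    classical
    have h1 := finite_coeff_X_ne (Option.some_injective (TimeVar N)) d
    refine (h1.union (Set.finite_range
      fun p : Fin N × Fin (d none + 1) => (Sum.inr (p.1, (p.2 : ℕ).toPNat') : TimeVar N))).subset ?_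
    rintro (v | ⟨α, j⟩) hv
    · exact Or.inl hv
    · by_contra hcon
      simp only [Set.mem_union, Set.mem_ofPred_eq, not_or, not_not, Set.mem_range, Prod.exists,
        not_exists] at hcon
      apply hv
      have hj : d ≠ Finsupp.single none (j : ℕ) := by
        intro hd
        have : d none = j := by rw [hd]; simp
        refine hcon.2 α ⟨j, by omega⟩ ?_
        simp
      by_cases h : α = γ
      · simp [shiftTbar, h, coeff_C_mul, coeff_X_pow, hj]
        simpa [h] using hcon.1
      · simp [shiftTbar, h]
        simpa using hcon.1

/-- The coefficients `w_j`, `w*_j`, `w̄_j`, `w̄*_j` of the (adjoint) wave functions: `N × N`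
matrices depending on `s ∈ ℤ^N` and on the times, normalized by `w_0 = w*_0 = 1` and with `w̄_0`,
`w̄*_0` invertible. -/
structure WaveData (N : ℕ) where
  w : (Fin N → ℤ) → ℕ → Matrix (Fin N) (Fin N) (TimeFun N)
  wStar : (Fin N → ℤ) → ℕ → Matrix (Fin N) (Fin N) (TimeFun N)
  wBar : (Fin N → ℤ) → ℕ → Matrix (Fin N) (Fin N) (TimeFun N)
  wBarStar : (Fin N → ℤ) → ℕ → Matrix (Fin N) (Fin N) (TimeFun N)
  w_zero : ∀ s, w s 0 = 1
  wStar_zero : ∀ s, wStar s 0 = 1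
  isUnit_wBar_zero : ∀ s, IsUnit (wBar s 0)
  isUnit_wBarStar_zero : ∀ s, IsUnit (wBarStar s 0)

namespace WaveData

variable {N : ℕ} (D : WaveData N)

/-- `Ψ_{αβ}(s,t,t̄;z) = (∑_j w_{j,αβ} z^{-j}) z^{s_β} e^{ξ(t_β,z)}`. -/
noncomputable def Psi (s : Fin N → ℤ) (α β : Fin N) : ZSeries (TimeVar N) :=
  sumNegPow (fun j => D.w s j α β) * zPow (s β) * expZ (xiT β)

/-- `Ψ*_{αβ}(s,t,t̄;z) = (∑_j w*_{j,αβ} z^{-j}) z^{-s_α} e^{-ξ(t_α,z)}`. -/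
noncomputable def PsiStar (s : Fin N → ℤ) (α β : Fin N) : ZSeries (TimeVar N) :=
  sumNegPow (fun j => D.wStar s j α β) * zPow (-s α) * expZ (-xiT α)

/-- `Ψ̄_{αβ}(s,t,t̄;z⁻¹)`, where
`Ψ̄_{αβ}(s,t,t̄;z) = (∑_j w̄_{j,αβ} z^j) z^{s_β} e^{ξ(t̄_β,z⁻¹)}`. -/
noncomputable def PsiBarInv (s : Fin N → ℤ) (α β : Fin N) : ZSeries (TimeVar N) :=
  sumNegPow (fun j => D.wBar s j α β) * zPow (-s β) * expZ (xiTbar β)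

/-- `Ψ̄*_{αβ}(s,t,t̄;z⁻¹)`, where
`Ψ̄*_{αβ}(s,t,t̄;z) = (∑_j w̄*_{j,αβ} z^j) z^{-s_α} e^{-ξ(t̄_α,z⁻¹)}`. -/
noncomputable def PsiBarStarInv (s : Fin N → ℤ) (α β : Fin N) : ZSeries (TimeVar N) :=
  sumNegPow (fun j => D.wBarStar s j α β) * zPow (s α) * expZ (-xiTbar α)

end WaveData

theorem tendstoCofinite_of_injective {σ τ : Type} {x : σ → τ} (hx : Function.Injective x) :
    Filter.TendstoCofinite x := ⟨hx.tendsto_cofinite⟩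

instance tendstoCofinite_inl {σ : Type} : Filter.TendstoCofinite (Sum.inl : σ → σ ⊕ σ) :=
  tendstoCofinite_of_injective Sum.inl_injective

instance tendstoCofinite_inr {σ : Type} : Filter.TendstoCofinite (Sum.inr : σ → σ ⊕ σ) :=
  tendstoCofinite_of_injective Sum.inr_injective

/-- `F` as a series in the first of two independent copies `(t, t̄)`, `(t', t̄')` of the times. -/
noncomputable def unprimed {σ : Type} (F : ZSeries σ) : ZSeries (σ ⊕ σ) :=
  rename (Sum.inl : σ → σ ⊕ σ) F

/-- `F` as a series in the second of two independent copies `(t, t̄)`, `(t', t̄')` of the times. -/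
noncomputable def primed {σ : Type} (F : ZSeries σ) : ZSeries (σ ⊕ σ) :=
  rename (Sum.inr : σ → σ ⊕ σ) F

/-- The bilinear identity: for all `α`, `β`, `s`, `s'` and identically in `t`, `t̄`, `t'`, `t̄'`,
`∑_γ ∮ Ψ_{αγ}(s,t,t̄;z) Ψ*_{γβ}(s',t',t̄';z) dz
  = ∑_γ ∮ Ψ̄_{αγ}(s,t,t̄;z⁻¹) Ψ̄*_{γβ}(s',t',t̄';z⁻¹) z⁻² dz`. -/
def BilinearIdentity {N : ℕ} (D : WaveData N) : Prop :=
  ∀ (s s' : Fin N → ℤ) (α β : Fin N),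
    ∑ γ, res (unprimed (D.Psi s α γ) * primed (D.PsiStar s' γ β)) =
      ∑ γ, res (unprimed (D.PsiBarInv s α γ) * primed (D.PsiBarStarInv s' γ β) * zPow (-2))

/-- Kronecker's `δ_{αβ}` as an integer. -/
def delta {N : ℕ} (α β : Fin N) : ℤ := if α = β then 1 else 0

/-- The sign `(-1)^{δ_{αβ} - 1}` as a constant series. -/
noncomputable def sgn {N : ℕ} (α β : Fin N) : ZSeries (TimeVar N) :=
  constZ (C ((-1 : ℂ) ^ (delta α β - 1)))

end MultiToda

/-! ### Miwa shifts as exponentials of derivations. -/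

namespace MultiToda

open Finset PowerSeries

/-! Since the second integrand is taken at `z⁻¹`, the `2N` families of times (`Dir N`) enter the
bilinear identity alike: each contributes a power of `z`, a series in `z⁻¹` and exponentials of `ξ`.
Barred and unbarred families differ only in the sign and in the power.

Put `t' = t - [a]` in one family `Γ`. The exponentials of `Γ` collapse to `1/(1 - a z)`, and the
residue against this kernel evaluates a series in `z⁻¹` at `a`. With `s' = s + dirShift Γ` this is
`one_shift`. Its entries say that the diagonal wave function of `Γ` is inverse to the shifted
diagonal adjoint one, and that the off-diagonal entries are the diagonal ones times `w_1`, suitably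
shifted (`wav_eq`, `diagWav_mul_adj`). It remains to find a scalar `τ` with `diagWav s Γ = τ(s +
dirShift Γ, t - [a]_Γ) / τ(s, t)`; the off-diagonal tau functions are then `w_{1,αβ} τ`.

Any such quotients satisfy a compatibility relation for pairs of families. Shifting `t'` in two
families at once proves it (`cocycle`). The operator `a ∂_a + ∑ a^k ∂_k` (`flow`) annihilates every
function of `t - [a]`; applied to the cocycle relation it shows that the coefficients of the
logarithmic derivatives of the diagonal wave functions form a closed form in all the times. Its
primitive, exponentiated, is `τ(s, ·)` up to a constant for each `s`. The constants have to match
under shifts of `s`, which amounts to trivializing a multiplicative cocycle on `ℤ^N`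
(`exists_of_lattice_cocycle`).

The shift is handled as `exp(-∑ a^k ∂_k / k)`, which turns the identities into ones about commuting
derivations; `collectZ_subst_eq` identifies it with the substitution in the statement. -/

theorem sum_antidiagonal_left_comm {M : Type*} [AddCommMonoid M] (f : ℕ → ℕ → ℕ → M) (n : ℕ) :
    ∑ p ∈ antidiagonal n, ∑ q ∈ antidiagonal p.2, f p.1 q.1 q.2 =
      ∑ p ∈ antidiagonal n, ∑ q ∈ antidiagonal p.2, f q.1 p.1 q.2 := by
  rw [sum_sigma', sum_sigma']
  refine sum_nbij' (fun x => ⟨(x.2.1, x.1.1 + x.2.2), (x.1.1, x.2.2)⟩)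
    (fun x => ⟨(x.2.1, x.1.1 + x.2.2), (x.1.1, x.2.2)⟩) ?_ ?_ ?_ ?_ ?_
  · simp; omega
  · simp; omega
  · rintro ⟨⟨a, b⟩, c, d⟩; simp +contextual; try omega
  · rintro ⟨⟨a, b⟩, c, d⟩; simp +contextual; try omega
  · simp

theorem sum_antidiagonal_assoc {M : Type*} [AddCommMonoid M] (f : ℕ → ℕ → ℕ → M) (n : ℕ) :
    ∑ p ∈ antidiagonal n, ∑ q ∈ antidiagonal p.1, f q.1 q.2 p.2 =
      ∑ p ∈ antidiagonal n, ∑ q ∈ antidiagonal p.2, f p.1 q.1 q.2 := by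
  rw [sum_sigma', sum_sigma']
  refine sum_nbij' (fun x => ⟨(x.2.1, x.2.2 + x.1.2), (x.2.2, x.1.2)⟩)
    (fun x => ⟨(x.1.1 + x.2.1, x.2.2), (x.1.1, x.2.1)⟩) ?_ ?_ ?_ ?_ ?_
  · simp; omega
  · simp; omega
  · rintro ⟨⟨a, b⟩, c, d⟩; simp +contextual; try omega
  · rintro ⟨⟨a, b⟩, c, d⟩; simp +contextual; try omega
  · simp

theorem sum_antidiagonal_four_comm {M : Type*} [AddCommMonoid M] (f : ℕ → ℕ → ℕ → ℕ → M) (n : ℕ) :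
    ∑ p ∈ antidiagonal n, ∑ q ∈ antidiagonal p.1, ∑ r ∈ antidiagonal p.2, f q.1 q.2 r.1 r.2 =
      ∑ p ∈ antidiagonal n, ∑ q ∈ antidiagonal p.1, ∑ r ∈ antidiagonal p.2,
        f q.1 r.1 q.2 r.2 := by
  simp_rw [sum_sigma']
  refine sum_nbij' (fun x => ⟨(x.2.1.1 + x.2.2.1, x.2.1.2 + x.2.2.2), (x.2.1.1, x.2.2.1), (x.2.1.2, x.2.2.2)⟩)
    (fun x => ⟨(x.2.1.1 + x.2.2.1, x.2.1.2 + x.2.2.2), (x.2.1.1, x.2.2.1), (x.2.1.2, x.2.2.2)⟩) ?_ ?_ ?_ ?_ ?_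
  · simp; omega
  · simp; omega
  · rintro ⟨⟨a, b⟩, ⟨c, d⟩, e, g⟩; simp; try omega
  · rintro ⟨⟨a, b⟩, ⟨c, d⟩, e, g⟩; simp; try omega
  · simp

/-- The sequence `0, d 0, d 1, …`. -/
def pad {M : Type*} [Zero M] (d : ℕ → M) : ℕ → M
  | 0 => 0
  | k + 1 => d k

section Schur

variable {M M' : Type*} [AddCommGroup M] [Module ℂ M] [AddCommGroup M'] [Module ℂ M']

/-- The coefficients of `exp (-∑_{k ≥ 1} d_{k-1} a^k / k)`, for commuting operators `d_k`. -/
noncomputable def schur (d : ℕ → Module.End ℂ M) : ℕ → Module.End ℂ M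
  | 0 => 1
  | n + 1 => -((n + 1 : ℂ)⁻¹ • ∑ k : Fin (n + 1), d k * schur d (n - k))

@[simp] theorem schur_zero (d : ℕ → Module.End ℂ M) : schur d 0 = 1 := by rw [schur]

/-- Coefficient form of `a ∂_a S = -(∑_{k ≥ 1} d_{k-1} a^k) S` for the generating series `S` of
`schur d`. This recursion, rather than an explicit formula, is what later proofs use. -/
theorem smul_schur (d : ℕ → Module.End ℂ M) (n : ℕ) :
    (n : ℂ) • schur d n = -∑ p ∈ antidiagonal n, pad d p.1 * schur d p.2 := by
  cases n with
  | zero => simp [pad]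
  | succ n =>
    rw [schur, smul_neg, smul_smul]
    have : ((n : ℂ) + 1) ≠ 0 := Nat.cast_add_one_ne_zero n
    push_cast
    rw [mul_inv_cancel₀ this, one_smul, Nat.sum_antidiagonal_succ,
      Nat.sum_antidiagonal_eq_sum_range_succ (fun i j => pad d (i + 1) * schur d j),
      ← Fin.sum_univ_eq_sum_range (fun k => pad d (k + 1) * schur d (n - k))]
    simp [pad]

/-- Transport principle for shifts: it moves them through residues, coefficients, `toZ` and
multiplication by constants. Homogeneity is a separate hypothesis so that additive maps and ring
homomorphisms can be used directly. -/
theorem map_schur_of_map_smul (φ : M →+ M') (hφ : ∀ (c : ℂ) x, φ (c • x) = c • φ x)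
    {d : ℕ → Module.End ℂ M} {d' : ℕ → Module.End ℂ M'}
    (h : ∀ k x, φ (d k x) = d' k (φ x)) (n : ℕ) (x : M) :
    φ (schur d n x) = schur d' n (φ x) := by
  induction n using Nat.strong_induction_on with
  | _ n ih =>
    cases n with
    | zero => simp
    | succ n =>
      rw [schur, schur]
      simp only [LinearMap.neg_apply, LinearMap.smul_apply, LinearMap.sum_apply,
        Module.End.mul_apply, map_neg, hφ, map_sum, h]
      congr 2
      exact sum_congr rfl fun k _ => by rw [ih _ (by omega)]

theorem map_schur (φ : M →ₗ[ℂ] M') {d : ℕ → Module.End ℂ M} {d' : ℕ → Module.End ℂ M'}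
    (h : ∀ k x, φ (d k x) = d' k (φ x)) (n : ℕ) (x : M) :
    φ (schur d n x) = schur d' n (φ x) :=
  map_schur_of_map_smul φ.toAddMonoidHom (map_smul φ) h n x

theorem commute_schur {T : Module.End ℂ M} {d : ℕ → Module.End ℂ M} (h : ∀ k, Commute T (d k))
    (n : ℕ) : Commute T (schur d n) :=
  LinearMap.ext fun x => map_schur T (fun k x => LinearMap.congr_fun (h k) x) n x

theorem commute_pad {T : Module.End ℂ M} {d : ℕ → Module.End ℂ M} (h : ∀ k, Commute T (d k))
    (n : ℕ) : Commute T (pad d n) := by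
  cases n with
  | zero => exact Commute.zero_right T
  | succ n => exact h n

theorem pad_neg {M : Type*} [AddGroup M] (d : ℕ → M) (n : ℕ) : pad (-d) n = -pad d n := by
  cases n <;> simp [pad]

/-- This is `exp(S) exp(-S) = 1`. Multiplication by `n` acts as `a ∂_a` on the product; by the
Leibniz rule and the recursion the two resulting terms cancel, because the operators commute. -/
theorem sum_schur_neg_mul_schur {d : ℕ → Module.End ℂ M} (h : ∀ k l, Commute (d k) (d l))
    {n : ℕ} (hn : n ≠ 0) : ∑ p ∈ antidiagonal n, schur (-d) p.1 * schur d p.2 = 0 := by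
  have hn' : (n : ℂ) ≠ 0 := Nat.cast_ne_zero.2 hn
  refine (smul_eq_zero_iff_right hn').1 ?_
  have h1 : (n : ℂ) • ∑ p ∈ antidiagonal n, schur (-d) p.1 * schur d p.2 =
      ∑ p ∈ antidiagonal n, (((p.1 : ℂ) • schur (-d) p.1) * schur d p.2 +
        schur (-d) p.1 * ((p.2 : ℂ) • schur d p.2)) := by
    rw [smul_sum]
    refine sum_congr rfl fun p hp => ?_
    rw [← HasAntidiagonal.mem_antidiagonal.1 hp, Nat.cast_add, add_smul, smul_mul_assoc, mul_smul_comm]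
  rw [h1]
  simp only [smul_schur, pad_neg, neg_mul, sum_neg_distrib, neg_neg, mul_neg, sum_mul, mul_sum,
    sum_add_distrib]
  have h2 := sum_antidiagonal_assoc (fun k i j => pad d k * schur (-d) i * schur d j) n
  have h3 := sum_antidiagonal_left_comm (fun k i j => pad d k * schur (-d) i * schur d j) n
  rw [h2, h3, ← sub_eq_add_neg, sub_eq_zero]
  refine sum_congr rfl fun p _ => sum_congr rfl fun q _ => ?_
  rw [← mul_assoc]
  congr 1
  refine ((commute_schur (d := -d) (T := pad d q.1) fun k => ?_) p.1)
  exact (commute_pad (T := (-d) k) (fun l => (h k l).neg_left) q.1).symm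

end Schur

section Flow

variable {A : Type*} [CommRing A] [Algebra ℂ A]

/-- The coefficientwise extension of a derivation to power series. -/
noncomputable def extD (δ : Derivation ℂ A A) : Derivation ℂ A⟦X⟧ A⟦X⟧ :=
  Derivation.mk'
    { toFun := fun F => mk fun n => δ (coeff n F)
      map_add' := fun F G => by ext; simp
      map_smul' := fun c F => by ext; simp }
    fun F G => by
      ext n
      simp [coeff_mul, Derivation.leibniz, sum_add_distrib]
      rw [← Nat.sum_antidiagonal_swap]
      rfl

@[simp] theorem coeff_extD (δ : Derivation ℂ A A) (F : A⟦X⟧) (n : ℕ) :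
    coeff n (extD δ F) = δ (coeff n F) := by
  change coeff n (mk fun n => δ (coeff n F)) = _
  simp

/-- The derivation `∑_k a^k d_k`, where `a` is the variable of the power series. -/
noncomputable def transl (d : ℕ → Derivation ℂ A A) : Derivation ℂ A⟦X⟧ A⟦X⟧ :=
  Derivation.mk'
    { toFun := fun F => mk fun n => ∑ p ∈ antidiagonal n, d p.1 (coeff p.2 F)
      map_add' := fun F G => by ext; simp [sum_add_distrib]
      map_smul' := fun c F => by ext; simp [smul_sum] }
    fun F G => by
      ext n
      change coeff n (mk fun n => ∑ p ∈ antidiagonal n, d p.1 (coeff p.2 (F * G))) =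
        coeff n (F * (mk fun n => ∑ p ∈ antidiagonal n, d p.1 (coeff p.2 G)) +
          G * (mk fun n => ∑ p ∈ antidiagonal n, d p.1 (coeff p.2 F)))
      simp only [coeff_mk, coeff_mul, map_sum, Derivation.leibniz, smul_eq_mul, sum_add_distrib,
        map_add, mul_sum]
      rw [sum_antidiagonal_left_comm (fun k i j => coeff i F * d k (coeff j G))]
      congr 1
      rw [sum_antidiagonal_left_comm (fun i k j => coeff i G * d k (coeff j F))]
      refine sum_congr rfl fun p _ => ?_
      rw [← Nat.sum_antidiagonal_swap]
      rfl

@[simp] theorem coeff_transl (d : ℕ → Derivation ℂ A A) (F : A⟦X⟧) (n : ℕ) :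
    coeff n (transl d F) = ∑ p ∈ antidiagonal n, d p.1 (coeff p.2 F) := by
  change coeff n (mk fun n => ∑ p ∈ antidiagonal n, d p.1 (coeff p.2 F)) = _
  simp

/-- The derivation `a ∂_a + ∑_{k ≥ 1} a^k d_{k-1}`. -/
noncomputable def flow (d : ℕ → Derivation ℂ A A) : Derivation ℂ A⟦X⟧ A⟦X⟧ :=
  (X : A⟦X⟧) • (d⁄dX A).restrictScalars ℂ + transl (pad d)

theorem coeff_flow (d : ℕ → Derivation ℂ A A) (F : A⟦X⟧) (n : ℕ) :
    coeff n (flow d F) = (n : ℂ) • coeff n F + ∑ p ∈ antidiagonal n, pad d p.1 (coeff p.2 F) := by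
  rw [← coeff_transl]
  change coeff n (X * d⁄dX A F + transl (pad d) F) = _
  rw [map_add]
  congr 1
  cases n with
  | zero => simp
  | succ n =>
    rw [coeff_succ_X_mul, coeff_derivative, Nat.cast_smul_eq_nsmul, nsmul_eq_mul, mul_comm]
    push_cast
    rfl

theorem coeff_flow_C (d : ℕ → Derivation ℂ A A) (f : A) (n : ℕ) :
    coeff n (flow d (C f)) = pad d n f := by
  rw [coeff_flow, sum_eq_single (n, 0)]
  · cases n <;> simp [pad, coeff_C]
  · rintro ⟨i, j⟩ hij hne
    rw [HasAntidiagonal.mem_antidiagonal] at hij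
    have : j ≠ 0 := by rintro rfl; exact hne (by simpa using hij)
    simp [coeff_C, this]
  · simp

theorem coeff_zero_flow (d : ℕ → Derivation ℂ A A) (F : A⟦X⟧) : coeff 0 (flow d F) = 0 := by
  simp [coeff_flow, pad]

/-- Uniqueness for an ordinary differential equation in `a`: at order `n` the term `n F_n` stands
alone, everything else involving coefficients of lower order. -/
theorem eq_zero_of_flow_eq {d : ℕ → Derivation ℂ A A} {F Ω : A⟦X⟧} (hF : flow d F = Ω * F)
    (hΩ : coeff 0 Ω = 0) (h0 : coeff 0 F = 0) : F = 0 := by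
  ext n
  rw [map_zero]
  induction n using Nat.strong_induction_on with
  | _ n ih =>
    rcases eq_or_ne n 0 with rfl | hn
    · exact h0
    have h := congrArg (coeff n) hF
    rw [coeff_flow, coeff_mul, sum_eq_zero, sum_eq_zero, add_zero] at h
    · exact (smul_eq_zero_iff_right (Nat.cast_ne_zero.2 hn : (n : ℂ) ≠ 0)).1 h
    · rintro ⟨i, j⟩ hij
      rw [HasAntidiagonal.mem_antidiagonal] at hij
      rcases eq_or_ne i 0 with rfl | hi
      · simp [hΩ]
      · simp only at hij ⊢
        rw [ih j (by omega), mul_zero]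
    · rintro ⟨i, j⟩ hij
      rw [HasAntidiagonal.mem_antidiagonal] at hij
      cases i with
      | zero => simp [pad]
      | succ i =>
        simp only at hij ⊢
        rw [ih j (by omega), map_zero]

/-- The operators `schur` for the linear maps underlying derivations. -/
noncomputable def dschur (d : ℕ → Derivation ℂ A A) : ℕ → Module.End ℂ A :=
  schur fun k => (d k : A →ₗ[ℂ] A)

@[simp] theorem dschur_zero (d : ℕ → Derivation ℂ A A) (f : A) : dschur d 0 f = f := by
  simp [dschur]

theorem smul_dschur (d : ℕ → Derivation ℂ A A) (n : ℕ) (f : A) :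
    (n : ℂ) • dschur d n f = -∑ p ∈ antidiagonal n, pad d p.1 (dschur d p.2 f) := by
  have h := LinearMap.congr_fun (smul_schur (fun k => (d k : A →ₗ[ℂ] A)) n) f
  simp only [LinearMap.smul_apply, LinearMap.neg_apply, LinearMap.sum_apply,
    Module.End.mul_apply] at h
  rw [dschur, h]
  congr 1
  refine sum_congr rfl fun p _ => ?_
  cases p.1 <;> rfl

theorem flow_mk_dschur (d : ℕ → Derivation ℂ A A) (f : A) :
    flow d (mk fun n => dschur d n f) = 0 := by
  ext n
  simp [coeff_flow, smul_dschur]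

/-- The kernel of `flow d` consists of the shifts `f(t - [a])`, with `f` read off at `a = 0`. As the
kernel of a derivation is closed under products, `miwa` is multiplicative. -/
theorem eq_mk_dschur {d : ℕ → Derivation ℂ A A} {F : A⟦X⟧} (hF : flow d F = 0) {f : A}
    (h0 : coeff 0 F = f) : F = mk fun n => dschur d n f := by
  rw [← sub_eq_zero]
  refine eq_zero_of_flow_eq (d := d) (Ω := 0) ?_ (by simp) (by rw [map_sub, h0]; simp)
  simp [map_sub, hF, flow_mk_dschur]

/-- The ring homomorphism `f ↦ exp (-∑_{k ≥ 1} d_{k-1} a^k / k) f`. -/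
noncomputable def miwa (d : ℕ → Derivation ℂ A A) : A →+* A⟦X⟧ where
  toFun f := mk fun n => dschur d n f
  map_one' := (eq_mk_dschur (by simp) (by simp)).symm
  map_mul' f g := (eq_mk_dschur (by simp [Derivation.leibniz, flow_mk_dschur])
    (by simp [coeff_zero_eq_constantCoeff])).symm
  map_zero' := by ext; simp
  map_add' f g := by ext; simp

@[simp] theorem coeff_miwa (d : ℕ → Derivation ℂ A A) (f : A) (n : ℕ) :
    coeff n (miwa d f) = dschur d n f := by
  change coeff n (mk fun n => dschur d n f) = _
  simp

theorem flow_miwa (d : ℕ → Derivation ℂ A A) (f : A) : flow d (miwa d f) = 0 :=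
  flow_mk_dschur d f

theorem dschur_mul (d : ℕ → Derivation ℂ A A) (n : ℕ) (f g : A) :
    dschur d n (f * g) = ∑ p ∈ antidiagonal n, dschur d p.1 f * dschur d p.2 g := by
  rw [← coeff_miwa, map_mul, coeff_mul]
  simp

theorem dschur_comm {d d' : ℕ → Derivation ℂ A A} (h : ∀ k l f, d k (d' l f) = d' l (d k f))
    (m n : ℕ) (f : A) : dschur d m (dschur d' n f) = dschur d' n (dschur d m f) := by
  refine (map_schur (dschur d m) (fun k x => ?_) n f)
  exact (map_schur (d' k : A →ₗ[ℂ] A) (fun l x => (h l k x).symm) m x).symm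

theorem map_dschur {B : Type*} [CommRing B] [Algebra ℂ B] (φ : A →+ B)
    (hφ : ∀ (c : ℂ) x, φ (c • x) = c • φ x) {d : ℕ → Derivation ℂ A A}
    {d' : ℕ → Derivation ℂ B B} (h : ∀ k x, φ (d k x) = d' k (φ x)) (n : ℕ) (x : A) :
    φ (dschur d n x) = dschur d' n (φ x) :=
  map_schur_of_map_smul φ hφ h n x

theorem dschur_mul_of_const {d : ℕ → Derivation ℂ A A} {c : A} (hc : ∀ k, d k c = 0) (n : ℕ)
    (x : A) : dschur d n (c * x) = c * dschur d n x :=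
  (map_dschur (AddMonoidHom.mulLeft c) (fun r y => mul_smul_comm r c y)
    (fun k y => by simp [hc]) n x).symm

theorem dschur_eq_zero {d : ℕ → Derivation ℂ A A} {x : A} (hx : ∀ k, d k x = 0) {n : ℕ}
    (hn : n ≠ 0) : dschur d n x = 0 := by
  have := eq_mk_dschur (d := d) (F := C x) (f := x) ?_ (by simp)
  · rw [← coeff_miwa]
    change coeff n (mk fun n => dschur d n x) = 0
    rw [← this, coeff_C, if_neg hn]
  · ext m
    rw [coeff_flow_C]
    cases m <;> simp [pad, hx]

/-- The shift of an exponential. -/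
theorem dschur_eq_pow_mul {d : ℕ → Derivation ℂ A A} {x z : A} (hz : ∀ k, d k z = 0)
    (hx : ∀ k, d k x = -(z ^ (k + 1) * x)) (n : ℕ) : dschur d n x = z ^ n * x := by
  have := eq_mk_dschur (d := d) (F := mk fun n => z ^ n * x) (f := x) ?_ (by simp)
  · have h := congrArg (coeff n) this
    rw [coeff_mk, coeff_mk] at h
    exact h.symm
  · ext m
    rw [coeff_flow, map_zero]
    simp only [coeff_mk]
    rcases m with _ | m
    · simp [pad]
    rw [Nat.sum_antidiagonal_succ]
    have h : ∀ p ∈ antidiagonal m, pad d (p.1 + 1) (z ^ p.2 * x) = -(z ^ (m + 1) * x) := by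
      intro p hp
      rw [← HasAntidiagonal.mem_antidiagonal.1 hp]
      simp [pad, Derivation.leibniz, Derivation.leibniz_pow, hz, hx]
      ring
    rw [sum_congr rfl h, sum_const, Nat.card_antidiagonal, ← Nat.cast_smul_eq_nsmul ℂ, smul_neg]
    simp [pad]

/-- The substitution `F(a) ↦ ∑_k a^k exp (-∑_{k ≥ 1} d_{k-1} a^k / k) F_k`. -/
noncomputable def miwaExt (d : ℕ → Derivation ℂ A A) : A⟦X⟧ →+* A⟦X⟧ where
  toFun F := mk fun n => ∑ p ∈ antidiagonal n, dschur d p.2 (coeff p.1 F)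
  map_one' := by
    ext n
    rw [coeff_mk, sum_eq_single (0, n)]
    · rw [coeff_zero_one, ← coeff_miwa, map_one]
    · rintro ⟨i, j⟩ hij hne
      rw [HasAntidiagonal.mem_antidiagonal] at hij
      have : i ≠ 0 := by rintro rfl; exact hne (by simpa using hij)
      simp [coeff_one, this]
    · simp
  map_mul' F G := by
    ext n
    simp only [coeff_mk, coeff_mul, map_sum, dschur_mul, sum_mul_sum]
    exact sum_antidiagonal_four_comm
      (fun i j p q => dschur d p (coeff i F) * dschur d q (coeff j G)) n
  map_zero' := by ext; simp
  map_add' F G := by ext; simp [sum_add_distrib]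

theorem coeff_miwaExt (d : ℕ → Derivation ℂ A A) (F : A⟦X⟧) (n : ℕ) :
    coeff n (miwaExt d F) = ∑ p ∈ antidiagonal n, dschur d p.2 (coeff p.1 F) := by
  change coeff n (mk fun n => ∑ p ∈ antidiagonal n, dschur d p.2 (coeff p.1 F)) = _
  simp

theorem miwaExt_C (d : ℕ → Derivation ℂ A A) (f : A) : miwaExt d (C f) = miwa d f := by
  ext n
  rw [coeff_miwaExt, sum_eq_single (0, n), coeff_miwa]
  · simp
  · rintro ⟨i, j⟩ hij hne
    rw [HasAntidiagonal.mem_antidiagonal] at hij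
    have : i ≠ 0 := by rintro rfl; exact hne (by simpa using hij)
    simp [coeff_C, this]
  · simp

theorem miwaExt_X (d : ℕ → Derivation ℂ A A) : miwaExt d X = X := by
  ext n
  rw [coeff_miwaExt]
  cases n with
  | zero => simp
  | succ n =>
    rw [sum_eq_single (1, n)]
    · simp only [coeff_X]
      rw [if_pos trivial, ← coeff_miwa, map_one, coeff_one]
      simp
    · rintro ⟨i, j⟩ hij hne
      rw [HasAntidiagonal.mem_antidiagonal] at hij
      have : i ≠ 1 := by rintro rfl; exact hne (by simp at hij ⊢; omega)
      simp [coeff_X, this]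
    · intro h
      exact absurd (HasAntidiagonal.mem_antidiagonal.2 (by simp; omega)) h

theorem sum_dschur_neg_dschur {d : ℕ → Derivation ℂ A A}
    (h : ∀ k l f, d k (d l f) = d l (d k f)) {n : ℕ} (hn : n ≠ 0) (f : A) :
    ∑ p ∈ antidiagonal n, dschur (-d) p.1 (dschur d p.2 f) = 0 := by
  have := LinearMap.congr_fun (sum_schur_neg_mul_schur
    (d := fun k => (d k : A →ₗ[ℂ] A)) (fun k l => LinearMap.ext (h k l)) hn) f
  simp only [LinearMap.sum_apply, Module.End.mul_apply] at this
  exact this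

/-- Undoes `F(a, t) ↦ F(a, t - [a])`. It is needed to pass from identities for shifted adjoint
functions to the adjoint functions themselves. -/
theorem miwaExt_neg_miwaExt {d : ℕ → Derivation ℂ A A}
    (h : ∀ k l f, d k (d l f) = d l (d k f)) (F : A⟦X⟧) : miwaExt (-d) (miwaExt d F) = F := by
  ext n
  simp only [coeff_miwaExt, map_sum]
  rw [sum_antidiagonal_assoc (fun i j k => dschur (-d) k (dschur d j (coeff i F))),
    sum_eq_single (n, 0)]
  · simp
  · rintro ⟨i, j⟩ hij hne
    rw [HasAntidiagonal.mem_antidiagonal] at hij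
    have hj : j ≠ 0 := by rintro rfl; exact hne (by simpa using hij)
    rw [← Nat.sum_antidiagonal_swap]
    exact sum_dschur_neg_dschur h hj _
  · simp

end Flow

end MultiToda

/-! ### Logarithmic derivatives of a multiplicative cocycle. -/

namespace MultiToda

open Finset PowerSeries

section Cocycle

variable {A : Type*} [CommRing A] [Algebra ℂ A]

theorem pad_comm {d : ℕ → Derivation ℂ A A} {δ : Derivation ℂ A A}
    (h : ∀ k f, δ (d k f) = d k (δ f)) (k : ℕ) (f : A) : δ (pad d k f) = pad d k (δ f) := by
  cases k with
  | zero => simp [pad]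
  | succ k => exact h k f

theorem flow_extD {d : ℕ → Derivation ℂ A A} {δ : Derivation ℂ A A}
    (h : ∀ k f, δ (d k f) = d k (δ f)) (F : A⟦X⟧) : flow d (extD δ F) = extD δ (flow d F) := by
  ext n
  simp [coeff_flow, pad_comm h]

theorem miwa_extD_flow {d d' : ℕ → Derivation ℂ A A} (h : ∀ k l f, d k (d' l f) = d' l (d k f))
    (F : A⟦X⟧) : extD (flow d) (miwa (fun k => extD (d' k)) F) =
      miwa (fun k => extD (d' k)) (flow d F) := by
  ext1 n
  rw [coeff_extD, coeff_miwa, coeff_miwa]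
  exact map_schur (flow d : A⟦X⟧ →ₗ[ℂ] A⟦X⟧)
    (fun k F => flow_extD (fun l f => (h l k f).symm) F) n F

theorem coeff_dschur_extD (d : ℕ → Derivation ℂ A A) (k n : ℕ) (F : A⟦X⟧) :
    coeff k (dschur (fun i => extD (d i)) n F) = dschur d n (coeff k F) :=
  map_schur ((coeff k).restrictScalars ℂ) (fun i F => coeff_extD (d i) F k) n F

/-- In `hc` the inner variable `a` belongs to `d` and the outer variable `b` to `d'`: it reads `f(t;
a) g'(t - [a]; b) = g(t; b) f'(t - [b]; a)`. Applying `flow d` in `a` kills the factor with `g'`,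
and dividing by the unit `f'(t - [b]; a)` leaves `Ω g = (∑ a^k d_{k-1} g) + Ω'(t - [b]) g`. The
conclusion is the coefficient of `a^k`. -/
theorem extD_pad_of_cocycle {d d' : ℕ → Derivation ℂ A A}
    (h : ∀ k l f, d k (d' l f) = d' l (d k f)) {f f' g g' Ω Ω' : A⟦X⟧}
    (hf : flow d f = Ω * f) (hf' : flow d f' = Ω' * f') (hu : IsUnit f')
    (hc : C f * PowerSeries.map (miwa d) g' =
      PowerSeries.map C g * miwa (fun k => extD (d' k)) f') (k : ℕ) :
    extD (pad d k) g = (C (coeff k Ω) - miwa d' (coeff k Ω')) * g := by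
  have hC : extD (flow d) (C f : A⟦X⟧⟦X⟧) = C Ω * C f := by
    ext1 n
    rw [coeff_extD, ← map_mul, ← hf]
    cases n <;> simp [coeff_C]
  have hM : extD (flow d) (PowerSeries.map (miwa d) g') = 0 := by
    ext1 n
    simp [flow_miwa]
  have key := congrArg (extD (flow d)) hc
  rw [Derivation.leibniz, Derivation.leibniz, miwa_extD_flow h, hf', hC, hM, smul_zero, zero_add,
    map_mul, smul_eq_mul, smul_eq_mul, smul_eq_mul] at key
  have hu' : IsUnit (miwa (fun k => extD (d' k)) f') := hu.map _
  have key2 : C Ω * PowerSeries.map C g = extD (flow d) (PowerSeries.map C g) +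
      PowerSeries.map C g * miwa (fun k => extD (d' k)) Ω' := by
    refine hu'.mul_left_injective ?_
    simp only
    linear_combination key - C Ω * hc
  ext m
  have key3 := congrArg (fun G => coeff k (coeff m G)) key2
  simp only [coeff_C_mul, map_add, coeff_extD, coeff_map, coeff_mul_C, coeff_flow_C] at key3
  simp only [coeff_mul m, coeff_map, map_sum, coeff_C_mul, coeff_miwa, coeff_dschur_extD] at key3
  rw [sub_mul, map_sub, coeff_C_mul, coeff_extD, key3, mul_comm (miwa d' _), coeff_mul]
  simp

/-- Apply `flow d'` to `δ log g = x - y(t - [b])`: the shifted term disappears, and `δ Ω = ∑ b^l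
d'_{l-1} x` remains. This yields closedness of the logarithmic derivatives. -/
theorem pad_coeff_eq_of_extD {d' : ℕ → Derivation ℂ A A} {δ : Derivation ℂ A A}
    (h : ∀ k f, δ (d' k f) = d' k (δ f)) {g Ω : A⟦X⟧} {x y : A} (hg : flow d' g = Ω * g)
    (hu : IsUnit g) (hx : extD δ g = (C x - miwa d' y) * g) (l : ℕ) :
    δ (coeff l Ω) = pad d' l x := by
  have key := congrArg (flow d') hx
  rw [flow_extD h, hg, Derivation.leibniz, Derivation.leibniz, map_sub, flow_miwa, hg, hx] at key
  simp only [smul_eq_mul, sub_zero] at key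
  have key2 : extD δ Ω = flow d' (C x) := by
    refine hu.mul_left_injective ?_
    simp only
    linear_combination key
  have := congrArg (coeff l) key2
  rwa [coeff_extD, coeff_flow_C] at this

end Cocycle

end MultiToda

/-! ### Formal exponentials and primitives of closed forms. -/

namespace MultiToda

open Finset MvPowerSeries

section Exp

variable {σ : Type} {K : Type} [CommRing K] [Algebra ℂ K]

/-- `F ^ k` has no terms of degree below `k`, so the exponential may be truncated when a single
coefficient is computed. The derivative of the exponential then follows from that of a finite sum.
-/
theorem coeff_exp_subst {F : MvPowerSeries σ K} (hF : constantCoeff F = 0) {m : σ →₀ ℕ} {n : ℕ}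
    (hn : m.degree < n) : coeff m ((PowerSeries.exp ℂ).subst F) =
      coeff m (∑ k ∈ range n, ((k.factorial : ℂ)⁻¹) • F ^ k) := by
  rw [PowerSeries.coeff_subst (PowerSeries.HasSubst.of_constantCoeff_zero hF),
    finsum_eq_sum_of_support_subset _ (s := range n)]
  · simp [PowerSeries.coeff_exp]
  · intro k hk
    rw [Function.mem_support] at hk
    by_contra h
    refine hk ?_
    rw [coeff_eq_zero_of_constantCoeff_nilpotent (m := 1) (by simp [hF]), smul_zero]
    simp at h
    omega

theorem pderiv_smul (v : σ) (c : ℂ) (F : MvPowerSeries σ K) :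
    pderiv K v (c • F) = c • pderiv K v F := by
  ext m
  change _ = c • coeff m (pderiv K v F)
  rw [coeff_pderiv, coeff_pderiv, ← smul_mul_assoc]
  rfl

theorem pderiv_sum_pow (F : MvPowerSeries σ K) (v : σ) (n : ℕ) :
    pderiv K v (∑ k ∈ range (n + 1), ((k.factorial : ℂ)⁻¹) • F ^ k) =
      (∑ k ∈ range n, ((k.factorial : ℂ)⁻¹) • F ^ k) * pderiv K v F := by
  rw [sum_range_succ', map_add, map_sum, sum_mul]
  have h0 : pderiv K v (((Nat.factorial 0 : ℕ) : ℂ)⁻¹ • F ^ 0) = 0 := by simp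
  rw [h0, add_zero]
  refine sum_congr rfl fun k _ => ?_
  rw [pderiv_smul, pderiv_pow, Nat.factorial_succ,
    Nat.add_sub_cancel, smul_mul_assoc, mul_assoc, ← nsmul_eq_mul, ← Nat.cast_smul_eq_nsmul ℂ,
    smul_smul]
  congr 1
  have := Nat.cast_add_one_ne_zero (R := ℂ) k
  push_cast
  field_simp

theorem pderiv_exp_subst {F : MvPowerSeries σ K} (hF : constantCoeff F = 0) (v : σ) :
    pderiv K v ((PowerSeries.exp ℂ).subst F) =
      pderiv K v F * (PowerSeries.exp ℂ).subst F := by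
  classical
  ext m
  have h1 : coeff m (pderiv K v ((PowerSeries.exp ℂ).subst F)) =
      coeff m (pderiv K v (∑ k ∈ range (m.degree + 1 + 1), ((k.factorial : ℂ)⁻¹) • F ^ k)) := by
    rw [coeff_pderiv, coeff_pderiv, coeff_exp_subst hF]
    simp
  rw [h1, pderiv_sum_pow, mul_comm, coeff_mul, coeff_mul]
  refine sum_congr rfl fun p hp => ?_
  rw [coeff_exp_subst hF (n := m.degree + 1)]
  rw [← HasAntidiagonal.mem_antidiagonal.1 hp, map_add]
  omega

theorem pderiv_exp_subst_neg {F : MvPowerSeries σ K} (hF : constantCoeff F = 0) (v : σ) :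
    pderiv K v ((PowerSeries.exp ℂ).subst (-F)) =
      -(pderiv K v F * (PowerSeries.exp ℂ).subst (-F)) := by
  rw [pderiv_exp_subst (by rw [map_neg, hF, neg_zero]), map_neg, neg_mul]

theorem pderiv_exp_subst_neg_of_eq_zero {F : MvPowerSeries σ K} (hF : constantCoeff F = 0) {v : σ}
    (h : pderiv K v F = 0) : pderiv K v ((PowerSeries.exp ℂ).subst (-F)) = 0 := by
  rw [pderiv_exp_subst_neg hF, h, zero_mul, neg_zero]

theorem constantCoeff_exp_subst {F : MvPowerSeries σ K} (hF : constantCoeff F = 0) :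
    constantCoeff ((PowerSeries.exp ℂ).subst F : MvPowerSeries σ K) = 1 := by
  rw [← coeff_zero_eq_constantCoeff_apply, coeff_exp_subst hF (n := 1) (by simp)]
  simp

end Exp

section Primitive

variable {σ : Type}

/-- A primitive of a closed form, given by the homotopy formula. -/
theorem exists_primitive {η : σ → MvPowerSeries σ ℂ}
    (h : ∀ u v, pderiv ℂ u (η v) = pderiv ℂ v (η u)) :
    ∃ L : MvPowerSeries σ ℂ, constantCoeff L = 0 ∧ ∀ v, pderiv ℂ v L = η v := by
  classical
  let L : MvPowerSeries σ ℂ := fun m =>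
    (m.degree : ℂ)⁻¹ * ∑ v ∈ m.support, coeff (m - Finsupp.single v 1) (η v)
  have hL : ∀ m, coeff m L =
    (m.degree : ℂ)⁻¹ * ∑ v ∈ m.support, coeff (m - Finsupp.single v 1) (η v) := fun m => rfl
  refine ⟨L, ?_, fun w => ?_⟩
  · rw [← coeff_zero_eq_constantCoeff_apply, hL]
    simp
  ext m
  rw [coeff_pderiv, hL]
  have hd : (((m + Finsupp.single w 1 : σ →₀ ℕ).degree : ℕ) : ℂ) = m.degree + 1 := by simp
  have hd0 : (m.degree : ℂ) + 1 ≠ 0 := Nat.cast_add_one_ne_zero _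
  rw [hd, mul_assoc, inv_mul_eq_iff_eq_mul₀ hd0, sum_mul]
  -- By closedness each summand is the multiplicity of `v` in `m + single w 1` times one common
  -- coefficient of `η w`. The multiplicities add up to the degree, which cancels the denominator.
  have key : ∀ v ∈ (m + Finsupp.single w 1).support,
      coeff (m + Finsupp.single w 1 - Finsupp.single v 1) (η v) * ((m w : ℂ) + 1) =
        (((m + Finsupp.single w 1 : σ →₀ ℕ) v : ℕ) : ℂ) * coeff m (η w) := by
    intro v hv
    rcases eq_or_ne v w with rfl | hvw
    · simp [mul_comm]
    · have hv' : m v ≠ 0 := by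
        simpa [Finsupp.single_apply, hvw.symm] using hv
      have hle : Finsupp.single v 1 ≤ m := by
        rw [Finsupp.single_le_iff]
        omega
      obtain ⟨m', rfl⟩ := exists_add_of_le hle
      have := congrArg (coeff m') (h w v)
      rw [coeff_pderiv, coeff_pderiv] at this
      have e : Finsupp.single v 1 + m' + Finsupp.single w 1 - Finsupp.single v 1 =
          m' + Finsupp.single w 1 := by
        rw [add_assoc, add_tsub_cancel_left]
      rw [e, add_comm (Finsupp.single v 1) m']
      simp only [Finsupp.add_apply, Finsupp.single_apply, hvw, hvw.symm, if_false,
        if_true, add_zero]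
      rw [this]
      push_cast
      ring
  rw [sum_congr rfl key, ← sum_mul]
  congr 1
  rw [← hd, Finsupp.degree_apply, Nat.cast_sum]

theorem exists_pderiv_eq_mul {η : σ → MvPowerSeries σ ℂ}
    (h : ∀ u v, pderiv ℂ u (η v) = pderiv ℂ v (η u)) :
    ∃ τ : MvPowerSeries σ ℂ, constantCoeff τ = 1 ∧ ∀ v, pderiv ℂ v τ = η v * τ := by
  obtain ⟨L, hL0, hL⟩ := exists_primitive h
  exact ⟨(PowerSeries.exp ℂ).subst L, constantCoeff_exp_subst hL0,
    fun v => by rw [pderiv_exp_subst hL0, hL]⟩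

end Primitive

section Xi

variable {σ : Type}

theorem coeff_X_mul_C [DecidableEq σ] {K : Type} [CommRing K] (v : σ) (c : K) (m : σ →₀ ℕ) :
    coeff m (X v * C c : MvPowerSeries σ K) = if m = Finsupp.single v 1 then c else 0 := by
  rw [mul_comm, coeff_C_mul, coeff_X]
  simp

theorem coeff_xi {x : ℕ+ → σ} (m : σ →₀ ℕ) :
    coeff m (xi x) = ∑ᶠ k : ℕ+, coeff m (X (x k) * zPow ((k : ℕ) : ℤ) : ZSeries σ) := rfl

theorem coeff_single_xi {x : ℕ+ → σ} (hx : Function.Injective x) (k : ℕ+) :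
    coeff (Finsupp.single (x k) 1) (xi x) = HahnSeries.single (-(k : ℤ)) (1 : ℂ) := by
  classical
  rw [coeff_xi, finsum_eq_single _ k]
  · rw [zPow, coeff_X_mul_C, if_pos rfl]
  · intro l hl
    rw [zPow, coeff_X_mul_C, if_neg]
    intro h
    exact hl (hx (Finsupp.single_left_injective one_ne_zero h).symm)

theorem coeff_xi_eq_zero {x : ℕ+ → σ} {m : σ →₀ ℕ} (h : ∀ k, m ≠ Finsupp.single (x k) 1) :
    coeff m (xi x) = 0 := by
  classical
  rw [coeff_xi]
  refine finsum_eq_zero_of_forall_eq_zero fun k => ?_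
  rw [zPow, coeff_X_mul_C, if_neg (h k)]

theorem add_single_eq_single {m : σ →₀ ℕ} {u v : σ}
    (h : m + Finsupp.single v 1 = Finsupp.single u 1) : m = 0 ∧ v = u := by
  classical
  have hv := DFunLike.congr_fun h v
  simp only [Finsupp.add_apply, Finsupp.single_eq_same] at hv
  have hvu : v = u := by
    by_contra hne
    rw [Finsupp.single_eq_of_ne hne] at hv
    omega
  subst hvu
  exact ⟨by simpa using h, rfl⟩

theorem pderiv_xi {x : ℕ+ → σ} (hx : Function.Injective x) (k : ℕ+) :
    pderiv (LaurentSeries ℂ) (x k) (xi x) = zPow (k : ℤ) := by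
  classical
  ext1 m
  rw [coeff_pderiv, zPow, coeff_C]
  rcases eq_or_ne m 0 with rfl | hm
  · simp [coeff_single_xi hx]
  · rw [if_neg hm, coeff_xi_eq_zero, zero_mul]
    intro l hl
    exact hm (add_single_eq_single hl).1

theorem pderiv_xi_of_ne {x : ℕ+ → σ} {v : σ} (hv : ∀ k, v ≠ x k) :
    pderiv (LaurentSeries ℂ) v (xi x) = 0 := by
  ext1 m
  rw [coeff_pderiv, coeff_xi_eq_zero, zero_mul, map_zero]
  intro l hl
  exact hv l (add_single_eq_single hl).2

theorem expZ_mul_expZ_neg {F : ZSeries σ} (hF : constantCoeff F = 0) :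
    expZ F * expZ (-F) = 1 := by
  have hF' : constantCoeff (-F) = 0 := by simp [hF]
  -- Without additive torsion, a series is determined by its partial derivatives and its constant
  -- term.
  have : IsAddTorsionFree (LaurentSeries ℂ) := IsAddTorsionFree.of_module_rat _
  refine pderiv.ext (fun v => ?_) ?_
  · rw [Derivation.leibniz, expZ, expZ, pderiv_exp_subst hF, pderiv_exp_subst hF', map_neg,
      pderiv_one, smul_eq_mul, smul_eq_mul]
    ring
  · rw [map_mul, expZ, expZ, constantCoeff_exp_subst hF, constantCoeff_exp_subst hF', map_one,
      mul_one]

end Xi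

end MultiToda

/-! ### Doubled variables, residues and series in `z⁻¹`. -/

namespace MultiToda

open Finset MvPowerSeries

section Rename

variable {σ τ : Type} {K : Type} [CommRing K]

theorem coeff_mapDomain_rename {x : σ → τ} [Filter.TendstoCofinite x] (hx : Function.Injective x)
    (F : MvPowerSeries σ K) (m : σ →₀ ℕ) :
    coeff (m.mapDomain x) (rename x F) = coeff m F := by
  have := coeff_embDomain_rename ⟨x, hx⟩ F m
  rwa [Finsupp.embDomain_eq_mapDomain] at this

theorem pderiv_rename {x : σ → τ} [Filter.TendstoCofinite x] (hx : Function.Injective x) (v : σ)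
    (F : MvPowerSeries σ K) : pderiv K (x v) (rename x F) = rename x (pderiv K v F) := by
  classical
  ext m
  rw [coeff_pderiv]
  by_cases hm : m ∈ Set.range (Finsupp.mapDomain x)
  · obtain ⟨m, rfl⟩ := hm
    have h1 : m.mapDomain x + Finsupp.single (x v) 1 =
        (m + Finsupp.single v 1).mapDomain x := by
      rw [Finsupp.mapDomain_add, Finsupp.mapDomain_single]
    rw [h1, coeff_mapDomain_rename hx, coeff_mapDomain_rename hx, coeff_pderiv,
      Finsupp.mapDomain_apply hx]
  · rw [coeff_rename_eq_zero _ _ hm, coeff_rename_eq_zero, zero_mul]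
    rintro ⟨m₁, h⟩
    have hv := DFunLike.congr_fun h (x v)
    rw [Finsupp.mapDomain_apply hx] at hv
    simp only [Finsupp.add_apply, Finsupp.single_eq_same] at hv
    have hle : Finsupp.single v 1 ≤ m₁ := by
      rw [Finsupp.single_le_iff]
      omega
    obtain ⟨m', rfl⟩ := exists_add_of_le hle
    refine hm ⟨m', ?_⟩
    rw [Finsupp.mapDomain_add, Finsupp.mapDomain_single, add_comm] at h
    exact add_right_cancel h

theorem pderiv_rename_of_notMem {x : σ → τ} [Filter.TendstoCofinite x] {u : τ}
    (hu : u ∉ Set.range x) (F : MvPowerSeries σ K) : pderiv K u (rename x F) = 0 := by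
  classical
  ext m
  rw [coeff_pderiv, coeff_rename_eq_zero, zero_mul, map_zero]
  rintro ⟨m₁, h⟩
  have h1 := DFunLike.congr_fun h u
  rw [Finsupp.mapDomain_of_notMem_range _ _ hu] at h1
  simp at h1

instance tendstoCofinite_fold : Filter.TendstoCofinite (Sum.elim id id : σ ⊕ σ → σ) := by
  rw [Filter.tendstoCofinite_iff_finite_preimage_singleton]
  intro b
  refine (Set.toFinite {Sum.inl b, Sum.inr b}).subset ?_
  rintro (a | a) h <;> simp_all

/-- Restriction of a series in two copies of the variables to the diagonal. -/
noncomputable def diag : MvPowerSeries (σ ⊕ σ) K →ₐ[K] MvPowerSeries σ K :=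
  rename (Sum.elim id id : σ ⊕ σ → σ)

theorem diag_unprimed (F : ZSeries σ) : diag (unprimed F) = F := by
  rw [diag, unprimed, rename_rename]
  exact rename_id_apply F

theorem diag_primed (F : ZSeries σ) : diag (primed F) = F := by
  rw [diag, primed, rename_rename]
  exact rename_id_apply F

end Rename

section ZSeries

variable {σ τ : Type}

theorem algebraMap_laurentSeries (c : ℂ) :
    algebraMap ℂ (LaurentSeries ℂ) c = HahnSeries.C c := by
  rw [HahnSeries.algebraMap_apply']
  simp

theorem smul_zSeries (c : ℂ) (F : ZSeries σ) : c • F = C (HahnSeries.C c) * F := by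
  rw [Algebra.smul_def, MvPowerSeries.algebraMap_apply, algebraMap_laurentSeries]

theorem coeff_smul_zSeries (c : ℂ) (F : ZSeries σ) (m : σ →₀ ℕ) (i : ℤ) :
    HahnSeries.coeff (coeff m (c • F)) i = c * HahnSeries.coeff (coeff m F) i := by
  rw [smul_zSeries, coeff_C_mul, HahnSeries.C_apply, HahnSeries.coeff_single_mul, sub_zero]

/-- The residue as an additive map. -/
noncomputable def resAdd : ZSeries σ →+ MvPowerSeries σ ℂ where
  toFun := res
  map_zero' := rfl
  map_add' F G := by
    ext m
    change HahnSeries.coeff (coeff m (F + G)) 1 = _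
    rw [map_add, HahnSeries.coeff_add]
    rfl

theorem resAdd_apply (F : ZSeries σ) : resAdd F = res F := rfl

theorem res_smul (c : ℂ) (F : ZSeries σ) : res (c • F) = c • res F := by
  ext m
  exact coeff_smul_zSeries c F m 1

theorem coeff_res (F : ZSeries σ) (m : σ →₀ ℕ) :
    coeff m (res F) = HahnSeries.coeff (coeff m F) 1 := rfl

theorem res_rename {x : σ → τ} [Filter.TendstoCofinite x] (F : ZSeries σ) :
    res (rename x F) = rename x (res F) := by
  ext m
  simp only [coeff_res, coeff_rename]
  exact map_sum (HahnSeries.coeff.addMonoidHom (1 : ℤ)) _ _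

/-- The partial derivative as a `ℂ`-linear derivation. -/
noncomputable def pd (K : Type) [CommRing K] [Algebra ℂ K] (v : σ) :
    Derivation ℂ (MvPowerSeries σ K) (MvPowerSeries σ K) :=
  (pderiv K v).restrictScalars ℂ

theorem pd_apply {K : Type} [CommRing K] [Algebra ℂ K] (v : σ) (F : MvPowerSeries σ K) :
    pd K v F = pderiv K v F := rfl

theorem pd_mul {K : Type} [CommRing K] [Algebra ℂ K] (v : σ) (F G : MvPowerSeries σ K) :
    pd K v (F * G) = F * pd K v G + G * pd K v F := by
  simp [Derivation.leibniz]

theorem pd_C {K : Type} [CommRing K] [Algebra ℂ K] (v : σ) (c : K) :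
    pd K v (C c) = 0 := by
  simp [pd_apply]

theorem pd_comm {K : Type} [CommRing K] [Algebra ℂ K] (u v : σ) (F : MvPowerSeries σ K) :
    pd K u (pd K v F) = pd K v (pd K u F) := by
  classical
  ext m
  simp only [pd_apply, coeff_pderiv, Finsupp.add_apply]
  rw [add_right_comm]
  rcases eq_or_ne u v with rfl | h
  · rfl
  · simp [Finsupp.single_eq_of_ne h, Finsupp.single_eq_of_ne h.symm]
    ring

theorem coeff_natCast_mul (x : LaurentSeries ℂ) (n : ℕ) (i : ℤ) :
    HahnSeries.coeff (x * ((n : LaurentSeries ℂ) + 1)) i = HahnSeries.coeff x i * (n + 1) := by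
  have h : x * ((n : LaurentSeries ℂ) + 1) = (n + 1) • x := by
    rw [nsmul_eq_mul, mul_comm]
    push_cast
    rfl
  rw [h, HahnSeries.coeff_nsmul, Pi.smul_apply, nsmul_eq_mul, mul_comm]
  push_cast
  rfl

theorem res_pd (v : σ) (F : ZSeries σ) : res (pd _ v F) = pd ℂ v (res F) := by
  ext m
  rw [coeff_res, pd_apply, pd_apply, coeff_pderiv, coeff_pderiv, coeff_natCast_mul, coeff_res]

/-- A power series in `z⁻¹`, regarded as a series in `z`. -/
noncomputable def toZ : PowerSeries (MvPowerSeries σ ℂ) →+* ZSeries σ where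
  toFun F := sumNegPow fun j => PowerSeries.coeff j F
  map_one' := by
    classical
    ext1 m
    change HahnSeries.ofPowerSeries ℤ ℂ (PowerSeries.mk fun j =>
      coeff m (PowerSeries.coeff j (1 : PowerSeries (MvPowerSeries σ ℂ)))) = _
    rw [coeff_one]
    split_ifs with h
    · rw [← map_one (HahnSeries.ofPowerSeries ℤ ℂ)]
      congr 1
      ext j
      rw [PowerSeries.coeff_mk, PowerSeries.coeff_one, PowerSeries.coeff_one]
      split_ifs <;> simp [h]
    · rw [← map_zero (HahnSeries.ofPowerSeries ℤ ℂ)]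
      congr 1
      ext j
      rw [PowerSeries.coeff_mk, PowerSeries.coeff_one]
      split_ifs <;> simp [h, coeff_one]
  map_mul' F G := by
    classical
    ext1 m
    rw [coeff_mul]
    change HahnSeries.ofPowerSeries ℤ ℂ (PowerSeries.mk fun j =>
      coeff m (PowerSeries.coeff j (F * G))) = ∑ p ∈ antidiagonal m,
        HahnSeries.ofPowerSeries ℤ ℂ (PowerSeries.mk fun j => coeff p.1 (PowerSeries.coeff j F)) *
        HahnSeries.ofPowerSeries ℤ ℂ (PowerSeries.mk fun j => coeff p.2 (PowerSeries.coeff j G))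
    simp_rw [← map_mul]
    rw [← map_sum]
    congr 1
    ext j
    simp only [PowerSeries.coeff_mk, PowerSeries.coeff_mul, map_sum, coeff_mul]
    exact sum_comm
  map_zero' := by
    ext1 m
    change HahnSeries.ofPowerSeries ℤ ℂ (PowerSeries.mk fun j =>
      coeff m (PowerSeries.coeff j (0 : PowerSeries (MvPowerSeries σ ℂ)))) = 0
    rw [← map_zero (HahnSeries.ofPowerSeries ℤ ℂ)]
    congr 1
  map_add' F G := by
    ext1 m
    rw [map_add]
    change HahnSeries.ofPowerSeries ℤ ℂ (PowerSeries.mk fun j =>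
      coeff m (PowerSeries.coeff j (F + G))) =
        HahnSeries.ofPowerSeries ℤ ℂ (PowerSeries.mk fun j => coeff m (PowerSeries.coeff j F)) +
        HahnSeries.ofPowerSeries ℤ ℂ (PowerSeries.mk fun j => coeff m (PowerSeries.coeff j G))
    rw [← map_add]
    congr 1

theorem toZ_apply (F : PowerSeries (MvPowerSeries σ ℂ)) :
    toZ F = sumNegPow fun j => PowerSeries.coeff j F := rfl

theorem sumNegPow_eq_toZ (a : ℕ → MvPowerSeries σ ℂ) : sumNegPow a = toZ (PowerSeries.mk a) := by
  rw [toZ_apply]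
  simp

theorem coeff_toZ (F : PowerSeries (MvPowerSeries σ ℂ)) (m : σ →₀ ℕ) (i : ℤ) :
    HahnSeries.coeff (coeff m (toZ F)) i =
      if i < 0 then 0 else coeff m (PowerSeries.coeff i.natAbs F) := by
  refine (PowerSeries.coeff_coe _ i).trans ?_
  rw [PowerSeries.coeff_mk]

theorem toZ_smul (c : ℂ) (F : PowerSeries (MvPowerSeries σ ℂ)) : toZ (c • F) = c • toZ F := by
  ext m i
  rw [coeff_smul_zSeries, coeff_toZ, coeff_toZ]
  split_ifs
  · simp
  · rfl

theorem toZ_extD (v : σ) (F : PowerSeries (MvPowerSeries σ ℂ)) :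
    toZ (extD (pd ℂ v) F) = pd _ v (toZ F) := by
  ext m i
  rw [pd_apply, coeff_pderiv, coeff_natCast_mul, coeff_toZ, coeff_toZ, coeff_extD]
  split_ifs
  · simp
  · rw [pd_apply, coeff_pderiv]

theorem zPow_add (m n : ℤ) : (zPow (m + n) : ZSeries σ) = zPow m * zPow n := by
  rw [zPow, zPow, zPow, ← map_mul, HahnSeries.single_mul_single, mul_one, neg_add]

@[simp] theorem zPow_zero : (zPow 0 : ZSeries σ) = 1 := by
  rw [zPow, neg_zero, HahnSeries.single_zero_one, map_one]

theorem toZ_X : toZ (PowerSeries.X : PowerSeries (MvPowerSeries σ ℂ)) = zPow (-1) := by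
  classical
  ext m i
  rw [coeff_toZ, zPow, coeff_C, PowerSeries.coeff_X]
  by_cases hm : m = 0
  · subst hm
    rw [if_pos rfl, HahnSeries.coeff_single]
    split_ifs <;> first | omega | simp
  · rw [if_neg hm]
    split_ifs <;> simp [coeff_one, hm]

theorem toZ_C (f : MvPowerSeries σ ℂ) : toZ (PowerSeries.C f) = constZ f := by
  ext m i
  rw [coeff_toZ, constZ, coeff_map, HahnSeries.C_apply, HahnSeries.coeff_single,
    PowerSeries.coeff_C]
  split_ifs <;> first | omega | simp

/-- The residue of `z ^ p * F` for a power series `F` in `z⁻¹`. -/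
noncomputable def coeffShift {A : Type*} [Semiring A] (p : ℤ) (F : PowerSeries A) : A :=
  if p + 1 < 0 then 0 else PowerSeries.coeff (p + 1).natAbs F

theorem res_zPow_mul_toZ (p : ℤ) (F : PowerSeries (MvPowerSeries σ ℂ)) :
    res (zPow p * toZ F) = coeffShift p F := by
  ext m
  rw [coeff_res, zPow, coeff_C_mul, HahnSeries.coeff_single_mul, one_mul, coeff_toZ, coeffShift]
  rw [sub_neg_eq_add, add_comm]
  split_ifs
  · simp
  · rfl

end ZSeries

end MultiToda

/-! ### Miwa shifts of the bilinear identity. -/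

namespace MultiToda

open Finset MvPowerSeries

section Directions

variable {N : ℕ}

/-- The families of times: `Sum.inl γ` is `(t_{γ,k})_k` and `Sum.inr γ` is `(t̄_{γ,k})_k`. -/
abbrev Dir (N : ℕ) : Type := Fin N ⊕ Fin N

/-- The component to which a family of times belongs. -/
def Dir.comp : Dir N → Fin N := Sum.elim id id

/-- The `(k + 1)`-st time of a family. -/
def timeVar : Dir N → ℕ → TimeVar N
  | Sum.inl γ, k => Sum.inl (γ, k.succPNat)
  | Sum.inr γ, k => Sum.inr (γ, k.succPNat)

theorem exists_timeVar (v : TimeVar N) : ∃ Γ k, v = timeVar Γ k := by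
  rcases v with ⟨γ, k⟩ | ⟨γ, k⟩
  · exact ⟨Sum.inl γ, k.natPred, by simp [timeVar]⟩
  · exact ⟨Sum.inr γ, k.natPred, by simp [timeVar]⟩

/-- The derivations with respect to the times of a family. -/
noncomputable def dT (K : Type) [CommRing K] [Algebra ℂ K] (Γ : Dir N) :
    ℕ → Derivation ℂ (MvPowerSeries (TimeVar N) K) (MvPowerSeries (TimeVar N) K) :=
  fun k => pd K (timeVar Γ k)

theorem dT_comm (K : Type) [CommRing K] [Algebra ℂ K] (Γ Γ' : Dir N) (k l : ℕ)
    (f : MvPowerSeries (TimeVar N) K) : dT K Γ k (dT K Γ' l f) = dT K Γ' l (dT K Γ k f) :=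
  pd_comm _ _ _

/-- The series `ξ` of a family of times. -/
noncomputable def xiDir : Dir N → ZSeries (TimeVar N) := Sum.elim xiT xiTbar

theorem constantCoeff_xiDir (Γ : Dir N) : constantCoeff (xiDir Γ) = 0 := by
  rcases Γ with γ | γ <;> exact constantCoeff_xi _

theorem pd_xiDir (Γ Δ : Dir N) (k : ℕ) :
    pd (LaurentSeries ℂ) (timeVar Γ k) (xiDir Δ) = if Γ = Δ then zPow ((k : ℤ) + 1) else 0 := by
  have h1 : ∀ γ : Fin N, Function.Injective fun k : ℕ+ => (Sum.inl (γ, k) : TimeVar N) :=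
    fun γ a b h => by simpa using h
  have h2 : ∀ γ : Fin N, Function.Injective fun k : ℕ+ => (Sum.inr (γ, k) : TimeVar N) :=
    fun γ a b h => by simpa using h
  rw [pd_apply]
  rcases Γ with γ | γ <;> rcases Δ with δ | δ <;>
    simp only [timeVar, xiDir, Sum.elim_inl, Sum.elim_inr, xiT, xiTbar, Sum.inl.injEq,
      Sum.inr.injEq, reduceCtorEq, if_false]
  · split_ifs with h
    · subst h
      rw [pderiv_xi (h1 γ)]
      simp
    · exact pderiv_xi_of_ne fun l hl => h (by simp at hl; exact hl.1)
  · exact pderiv_xi_of_ne fun l hl => by simp at hl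
  · exact pderiv_xi_of_ne fun l hl => by simp at hl
  · split_ifs with h
    · subst h
      rw [pderiv_xi (h2 γ)]
      simp
    · exact pderiv_xi_of_ne fun l hl => h (by simp at hl; exact hl.1)

theorem pd_zPow (v : TimeVar N) (p : ℤ) : pd (LaurentSeries ℂ) v (zPow p) = 0 :=
  pd_C v _

theorem dschur_zPow_mul (Γ : Dir N) (n : ℕ) (p : ℤ) (F : ZSeries (TimeVar N)) :
    dschur (dT (LaurentSeries ℂ) Γ) n (zPow p * F) = zPow p * dschur (dT _ Γ) n F :=
  dschur_mul_of_const (fun _ => pd_zPow _ p) n F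

theorem zPow_one_pow {σ : Type} (n : ℕ) : (zPow 1 : ZSeries σ) ^ n = zPow (n : ℤ) := by
  induction n with
  | zero => simp
  | succ n ih => rw [pow_succ, ih, ← zPow_add, Nat.cast_succ]

/-- `e^{-ξ}` for a family of times. -/
noncomputable def expNeg (Γ : Dir N) : ZSeries (TimeVar N) := expZ (-xiDir Γ)

theorem pd_expNeg_self (Γ : Dir N) (k : ℕ) :
    pd (LaurentSeries ℂ) (timeVar Γ k) (expNeg Γ) = -(zPow ((k : ℤ) + 1) * expNeg Γ) := by
  have h := pd_xiDir Γ Γ k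
  rw [if_pos rfl] at h
  rw [← h]
  exact pderiv_exp_subst_neg (constantCoeff_xiDir Γ) (timeVar Γ k)

theorem pd_expNeg_of_ne {Γ Δ : Dir N} (h : Γ ≠ Δ) (k : ℕ) :
    pd (LaurentSeries ℂ) (timeVar Γ k) (expNeg Δ) = 0 :=
  pderiv_exp_subst_neg_of_eq_zero (constantCoeff_xiDir Δ) ((pd_xiDir Γ Δ k).trans (if_neg h))

/-- For `Γ = Δ` this is `e^{-ξ(t - [a], z)} = e^{-ξ(t, z)} / (1 - a z)`, read at `a^n`. -/
theorem dschur_expNeg (Γ Δ : Dir N) (n : ℕ) :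
    dschur (dT (LaurentSeries ℂ) Γ) n (expNeg Δ) =
      if Γ = Δ ∨ n = 0 then zPow (n : ℤ) * expNeg Δ else 0 := by
  by_cases h : Γ = Δ
  · subst h
    rw [if_pos (Or.inl rfl), ← zPow_one_pow]
    refine dschur_eq_pow_mul (fun k => pd_zPow _ 1) (fun k => ?_) n
    rw [zPow_one_pow]
    push_cast
    exact pd_expNeg_self Γ k
  · rcases eq_or_ne n 0 with rfl | hn
    · simp
    · rw [if_neg (by simp [h, hn])]
      exact dschur_eq_zero (fun k => pd_expNeg_of_ne h k) hn

/-- The shift operators acting on the coefficients of a power series. -/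
noncomputable def shiftX (Γ : Dir N) (n : ℕ) : Module.End ℂ (PowerSeries (TimeFun N)) :=
  dschur (fun k => extD (dT ℂ Γ k)) n

theorem coeff_shiftX (Γ : Dir N) (n k : ℕ) (F : PowerSeries (TimeFun N)) :
    PowerSeries.coeff k (shiftX Γ n F) = dschur (dT ℂ Γ) n (PowerSeries.coeff k F) :=
  coeff_dschur_extD _ _ _ _

theorem dschur_toZ (Γ : Dir N) (n : ℕ) (F : PowerSeries (TimeFun N)) :
    dschur (dT (LaurentSeries ℂ) Γ) n (toZ F) = toZ (shiftX Γ n F) :=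
  (map_dschur (toZ (σ := TimeVar N)).toAddMonoidHom toZ_smul
    (fun k F => toZ_extD (timeVar Γ k) F) n F).symm

theorem dschur_toZ_mul (Γ Δ : Dir N) (n : ℕ) (V : PowerSeries (TimeFun N)) (q : ℤ) :
    dschur (dT (LaurentSeries ℂ) Γ) n (toZ V * (zPow q * expNeg Δ)) =
      ∑ p ∈ antidiagonal n, if Γ = Δ ∨ p.1 = 0 then
        toZ (shiftX Γ p.2 V) * (zPow (q + p.1) * expNeg Δ) else 0 := by
  rw [dschur_mul, ← Nat.sum_antidiagonal_swap]
  refine sum_congr rfl fun p _ => ?_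
  rw [dschur_zPow_mul, dschur_expNeg, dschur_toZ]
  simp only [Prod.fst_swap, Prod.snd_swap]
  split_ifs
  · rw [zPow_add, mul_assoc (zPow q)]
  · simp

/-- At equal times the two exponentials cancel. What survives of them is one geometric series in `z`
for each of the two shifts that takes place in the family `Δ`. -/
theorem res_mul_dschur_dschur (Γ Γ' Δ : Dir N) (n m : ℕ) (U V : PowerSeries (TimeFun N))
    (p q : ℤ) :
    res ((toZ U * (zPow p * expZ (xiDir Δ))) *
      dschur (dT (LaurentSeries ℂ) Γ) n (dschur (dT (LaurentSeries ℂ) Γ') m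
        (toZ V * (zPow q * expNeg Δ)))) =
      ∑ b ∈ antidiagonal m, if Γ' = Δ ∨ b.1 = 0 then
        ∑ a ∈ antidiagonal n, if Γ = Δ ∨ a.1 = 0 then
          coeffShift (p + q + a.1 + b.1) (U * shiftX Γ a.2 (shiftX Γ' b.2 V)) else 0 else 0 := by
  rw [dschur_toZ_mul, map_sum, mul_sum, ← resAdd_apply, map_sum]
  refine sum_congr rfl fun b _ => ?_
  split_ifs with hb
  · rw [dschur_toZ_mul, mul_sum, map_sum]
    refine sum_congr rfl fun a _ => ?_
    split_ifs with ha
    · rw [resAdd_apply, ← res_zPow_mul_toZ]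
      congr 1
      have h := expZ_mul_expZ_neg (constantCoeff_xiDir Δ)
      rw [map_mul toZ, zPow_add, zPow_add, zPow_add, zPow_add, zPow_add, expNeg]
      linear_combination (toZ U * toZ (shiftX Γ a.2 (shiftX Γ' b.2 V)) * zPow p * zPow q *
        zPow a.1 * zPow b.1) * h
    · simp
  · simp

end Directions

section Bilinear

variable {N : ℕ}

/-- The derivations with respect to the primed times of a family. -/
noncomputable def dT' (K : Type) [CommRing K] [Algebra ℂ K] (Γ : Dir N) :
    ℕ → Derivation ℂ (MvPowerSeries (TimeVar N ⊕ TimeVar N) K)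
      (MvPowerSeries (TimeVar N ⊕ TimeVar N) K) :=
  fun k => pd K (Sum.inr (timeVar Γ k))

theorem pd_unprimed_mul_primed (v : TimeVar N) (A B : ZSeries (TimeVar N)) :
    pd (LaurentSeries ℂ) (Sum.inr v) (unprimed A * primed B) = unprimed A * primed (pd _ v B) := by
  rw [pd_mul, pd_apply _ (unprimed A), pd_apply _ (primed B), unprimed,
    pderiv_rename_of_notMem (by simp), primed, pderiv_rename Sum.inr_injective, mul_zero, add_zero,
    primed, pd_apply]

theorem dschur_unprimed_mul_primed (Γ : Dir N) (n : ℕ) (A B : ZSeries (TimeVar N)) :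
    dschur (dT' (LaurentSeries ℂ) Γ) n (unprimed A * primed B) =
      unprimed A * primed (dschur (dT _ Γ) n B) := by
  refine (map_dschur ((AddMonoidHom.mulLeft (unprimed A)).comp
    (rename (Sum.inr : TimeVar N → TimeVar N ⊕ TimeVar N) :
      ZSeries (TimeVar N) →ₐ[LaurentSeries ℂ] _).toRingHom.toAddMonoidHom) (fun c F => ?_)
    (fun k F => ?_) n B).symm
  · change unprimed A * rename Sum.inr (c • F) = c • (unprimed A * rename Sum.inr F)
    rw [smul_zSeries, smul_zSeries, map_mul, rename_C]
    ring
  · exact (pd_unprimed_mul_primed (timeVar Γ k) A F).symm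

/-- Setting `t' = t - [a] - [b]` is done by shifting only the primed copy and then restricting to
the diagonal; both operations commute with the residue. -/
theorem diag_dschur_res (Γ Γ' : Dir N) (n m : ℕ) (A B : ZSeries (TimeVar N)) :
    diag (dschur (dT' ℂ Γ) n (dschur (dT' ℂ Γ') m (res (unprimed A * primed B)))) =
      res (A * dschur (dT (LaurentSeries ℂ) Γ) n (dschur (dT (LaurentSeries ℂ) Γ') m B)) := by
  have h : ∀ (Γ : Dir N) (n : ℕ) (F : ZSeries (TimeVar N ⊕ TimeVar N)),
      dschur (dT' ℂ Γ) n (res F) = res (dschur (dT' (LaurentSeries ℂ) Γ) n F) := fun Γ n F =>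
    (map_dschur resAdd res_smul (fun k F => res_pd (Sum.inr (timeVar Γ k)) F) n F).symm
  rw [h, h, dschur_unprimed_mul_primed, dschur_unprimed_mul_primed, diag, ← res_rename, map_mul]
  congr 2
  · exact diag_unprimed A
  · exact diag_primed _

namespace WaveData

variable (D : WaveData N)

/-- The coefficients of `Ψ` and of `Ψ̄`. -/
noncomputable def wav (s : Fin N → ℤ) (i : Fin N) : Dir N → PowerSeries (TimeFun N)
  | Sum.inl γ => PowerSeries.mk fun j => D.w s j i γ
  | Sum.inr γ => PowerSeries.mk fun j => D.wBar s j i γ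

/-- The coefficients of `Ψ*` and of `Ψ̄*`. -/
noncomputable def adj (s : Fin N → ℤ) : Dir N → Fin N → PowerSeries (TimeFun N)
  | Sum.inl γ, j => PowerSeries.mk fun k => D.wStar s k γ j
  | Sum.inr γ, j => PowerSeries.mk fun k => D.wBarStar s k γ j

end WaveData

/-- The sign with which a family of times enters the bilinear identity. -/
def dirSign : Dir N → ℤ := Sum.elim (fun _ => 1) fun _ => -1

/-- The power of `z` with which a family of times enters the bilinear identity. -/
def dirPow (s s' : Fin N → ℤ) : Dir N → ℤ :=
  Sum.elim (fun γ => s γ - s' γ) fun γ => s' γ - s γ - 2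

/-- The bilinear identity after shifting the primed times in two families. -/
theorem BilinearIdentity.shifted {D : WaveData N} (hD : BilinearIdentity D) (s s' : Fin N → ℤ)
    (i j : Fin N) (Γ Γ' : Dir N) (n m : ℕ) :
    ∑ Δ, dirSign Δ • ∑ b ∈ antidiagonal m, (if Γ' = Δ ∨ b.1 = 0 then
        ∑ a ∈ antidiagonal n, if Γ = Δ ∨ a.1 = 0 then
          coeffShift (dirPow s s' Δ + a.1 + b.1)
            (D.wav s i Δ * shiftX Γ a.2 (shiftX Γ' b.2 (D.adj s' Δ j))) else 0 else 0) = 0 := by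
  have key := congrArg (fun f => diag (dschur (dT' ℂ Γ) n (dschur (dT' ℂ Γ') m f)))
    (hD s s' i j)
  simp only [map_sum] at key
  rw [Fintype.sum_sum_type]
  simp only [dirSign, Sum.elim_inl, Sum.elim_inr, one_smul, neg_smul, sum_neg_distrib]
  rw [← sub_eq_add_neg, sub_eq_zero]
  refine Eq.trans (sum_congr rfl fun γ _ => ?_) (key.trans (sum_congr rfl fun γ _ => ?_))
  · rw [diag_dschur_res]
    have h1 : D.Psi s i γ =
        toZ (D.wav s i (Sum.inl γ)) * (zPow (s γ) * expZ (xiDir (Sum.inl γ))) := by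
      rw [WaveData.Psi, sumNegPow_eq_toZ, mul_assoc]
      rfl
    have h2 : D.PsiStar s' γ j =
        toZ (D.adj s' (Sum.inl γ) j) * (zPow (-s' γ) * expNeg (Sum.inl γ)) := by
      rw [WaveData.PsiStar, sumNegPow_eq_toZ, mul_assoc]
      rfl
    rw [h1, h2, res_mul_dschur_dschur]
    rfl
  -- The factor `z⁻²` is absorbed into the unprimed wave function, so that the barred terms take the
  -- same form as the unbarred ones.
  · have h0 : unprimed (D.PsiBarInv s i γ) * primed (D.PsiBarStarInv s' γ j) * zPow (-2) =
        unprimed (D.PsiBarInv s i γ * zPow (-2)) * primed (D.PsiBarStarInv s' γ j) := by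
      rw [unprimed, unprimed, map_mul, zPow, zPow, rename_C]
      ring
    have h1 : D.PsiBarInv s i γ * zPow (-2) =
        toZ (D.wav s i (Sum.inr γ)) * (zPow (-s γ + -2) * expZ (xiDir (Sum.inr γ))) := by
      rw [WaveData.PsiBarInv, sumNegPow_eq_toZ, zPow_add]
      change toZ (D.wav s i (Sum.inr γ)) * _ * expZ (xiDir (Sum.inr γ)) * _ = _
      ring
    have h2 : D.PsiBarStarInv s' γ j =
        toZ (D.adj s' (Sum.inr γ) j) * (zPow (s' γ) * expNeg (Sum.inr γ)) := by
      rw [WaveData.PsiBarStarInv, sumNegPow_eq_toZ, mul_assoc]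
      rfl
    rw [h0, diag_dschur_res, h1, h2, res_mul_dschur_dschur]
    have h3 : dirPow s s' (Sum.inr γ) = -s γ + -2 + s' γ := by
      simp only [dirPow, Sum.elim_inr]
      ring
    rw [h3]

end Bilinear

end MultiToda

/-! ### Residues against geometric kernels. -/

namespace MultiToda

open Finset PowerSeries

section Residues

variable {N : ℕ}

theorem sum_antidiagonal_ite_fst {M : Type*} [AddCommMonoid M] (g : ℕ × ℕ → M) (n : ℕ) :
    ∑ p ∈ antidiagonal n, (if p.1 = 0 then g p else 0) = g (0, n) := by
  rw [sum_eq_single (0, n)]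
  · simp
  · rintro ⟨i, j⟩ hij hne
    rw [HasAntidiagonal.mem_antidiagonal] at hij
    rw [if_neg]
    rintro rfl
    exact hne (by simpa using hij)
  · simp

/-- The contribution of a family `Δ` to the bilinear identity with shifts in `Γ` and `Γ'`. -/
noncomputable def dirTerm (Γ Γ' Δ : Dir N) (p : ℤ) (U V : PowerSeries (TimeFun N)) (n m : ℕ) :
    TimeFun N :=
  ∑ b ∈ antidiagonal m, if Γ' = Δ ∨ b.1 = 0 then
    ∑ a ∈ antidiagonal n, if Γ = Δ ∨ a.1 = 0 then
      coeffShift (p + a.1 + b.1) (U * shiftX Γ a.2 (shiftX Γ' b.2 V)) else 0 else 0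

/-- The residue of `z ^ p * U * V(t - [a]) / (1 - a z)` at `a ^ n`. -/
noncomputable def shiftRes (Γ : Dir N) (p : ℤ) (U V : PowerSeries (TimeFun N)) (n : ℕ) :
    TimeFun N :=
  ∑ a ∈ antidiagonal n, coeffShift (p + a.1) (U * shiftX Γ a.2 V)

theorem dirTerm_of_ne {Γ Γ' Δ : Dir N} (h : Γ ≠ Δ) (h' : Γ' ≠ Δ) (p : ℤ)
    (U V : PowerSeries (TimeFun N)) (n m : ℕ) :
    dirTerm Γ Γ' Δ p U V n m = coeffShift p (U * shiftX Γ n (shiftX Γ' m V)) := by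
  simp only [dirTerm, h, h', false_or, sum_antidiagonal_ite_fst]
  simp

theorem shiftX_comm (Γ Γ' : Dir N) (n m : ℕ) (V : PowerSeries (TimeFun N)) :
    shiftX Γ n (shiftX Γ' m V) = shiftX Γ' m (shiftX Γ n V) := by
  ext k
  simp only [coeff_shiftX]
  rw [dschur_comm (fun k l f => dT_comm ℂ Γ Γ' k l f)]

@[simp] theorem shiftX_zero (Γ : Dir N) (V : PowerSeries (TimeFun N)) : shiftX Γ 0 V = V := by
  simp [shiftX]

theorem dirTerm_left {Γ Γ' : Dir N} (h : Γ' ≠ Γ) (p : ℤ) (U V : PowerSeries (TimeFun N))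
    (n m : ℕ) : dirTerm Γ Γ' Γ p U V n m = shiftRes Γ p U (shiftX Γ' m V) n := by
  simp only [dirTerm, h, false_or, sum_antidiagonal_ite_fst, true_or, if_true, shiftRes]
  simp

theorem dirTerm_right {Γ Γ' : Dir N} (h : Γ ≠ Γ') (p : ℤ) (U V : PowerSeries (TimeFun N))
    (n m : ℕ) : dirTerm Γ Γ' Γ' p U V n m = shiftRes Γ' p U (shiftX Γ n V) m := by
  simp only [dirTerm, h, false_or, sum_antidiagonal_ite_fst, true_or, if_true, shiftRes]
  refine sum_congr rfl fun b _ => ?_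
  rw [shiftX_comm Γ Γ']
  simp

theorem dirTerm_zero_right (Γ : Dir N) (p : ℤ) (U V : PowerSeries (TimeFun N)) (n : ℕ) :
    dirTerm Γ Γ Γ p U V n 0 = shiftRes Γ p U V n := by
  simp [dirTerm, shiftRes]

theorem coeffShift_natCast {A : Type*} [Semiring A] (k : ℕ) (F : A⟦X⟧) :
    coeffShift (k : ℤ) F = coeff (k + 1) F := by
  rw [coeffShift, if_neg (by omega)]
  congr 1

theorem coeffShift_zero {A : Type*} [Semiring A] (F : A⟦X⟧) : coeffShift 0 F = coeff 1 F :=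
  coeffShift_natCast 0 F

theorem coeffShift_neg_one_add {A : Type*} [Semiring A] (k : ℕ) (F : A⟦X⟧) :
    coeffShift (-1 + (k : ℤ)) F = coeff k F := by
  have h : (-1 + (k : ℤ) + 1).natAbs = k := by omega
  rw [coeffShift, if_neg (by omega), h]

theorem coeffShift_neg_one {A : Type*} [Semiring A] (F : A⟦X⟧) : coeffShift (-1) F = coeff 0 F :=
  coeffShift_neg_one_add 0 F

theorem coeffShift_neg_two {A : Type*} [Semiring A] (F : A⟦X⟧) : coeffShift (-2) F = 0 := by
  simp [coeffShift]

theorem coeff_mul_miwaExt (Γ : Dir N) (U V : PowerSeries (TimeFun N)) (n : ℕ) :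
    coeff n (U * miwaExt (dT ℂ Γ) V) =
      ∑ a ∈ antidiagonal n, coeff a.1 (U * shiftX Γ a.2 V) := by
  simp only [coeff_mul n, coeff_miwaExt, mul_sum]
  rw [← sum_antidiagonal_assoc
    (fun i k l => coeff i U * dschur (dT ℂ Γ) l (coeff k V))]
  refine sum_congr rfl fun a _ => ?_
  simp only [coeff_mul, coeff_shiftX]

/-- The residue of `z⁻¹ F(z⁻¹) / (1 - a z)` is `F(a)`; here `F` also depends on `a` through the
shift of `V`. -/
theorem shiftRes_neg_one (Γ : Dir N) (U V : PowerSeries (TimeFun N)) (n : ℕ) :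
    shiftRes Γ (-1) U V n = coeff n (U * miwaExt (dT ℂ Γ) V) := by
  rw [coeff_mul_miwaExt, shiftRes]
  exact sum_congr rfl fun a _ => coeffShift_neg_one_add _ _

/-- The residue of `F(z⁻¹) / (1 - a z)` is `(F(a) - F(0)) / a`. The division by `a` accounts for the
index `n + 1`. -/
theorem shiftRes_zero (Γ : Dir N) (U V : PowerSeries (TimeFun N)) (n : ℕ) :
    shiftRes Γ 0 U V n = coeff (n + 1) (U * miwaExt (dT ℂ Γ) V) -
      coeff 0 (U * shiftX Γ (n + 1) V) := by
  rw [coeff_mul_miwaExt, shiftRes, Nat.sum_antidiagonal_succ, add_sub_cancel_left]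
  refine sum_congr rfl fun a _ => ?_
  rw [zero_add, coeffShift_natCast]

/-- The shift of `s` that accompanies the shift of a family of times. -/
def dirShift : Dir N → Fin N → ℤ := Sum.elim (fun _ => 0) fun γ => Pi.single γ 1

/-- The factor `a` or `-1` attached to a family of times. -/
noncomputable def dirCoef : Dir N → PowerSeries (TimeFun N) :=
  Sum.elim (fun _ => X) fun _ => -1

/-- The indicator of `i = j = α`. -/
def unitEntry {A : Type*} [Zero A] [One A] (α i j : Fin N) : A :=
  if i = α ∧ j = α then 1 else 0

/-- The contribution of a family together with that of its conjugate family. -/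
noncomputable def dirRes (Γ : Dir N) (U V : PowerSeries (TimeFun N)) (c : TimeFun N) :
    PowerSeries (TimeFun N) :=
  match Γ with
  | Sum.inl γ => mk fun n => shiftRes (Sum.inl γ) 0 U V n
  | Sum.inr γ => mk fun n => -shiftRes (Sum.inr γ) (-1) U V n + coeff n (C c)

theorem dirCoef_mul_dirRes (Γ : Dir N) (U V : PowerSeries (TimeFun N)) (c : TimeFun N)
    (h : ∀ γ, Γ = Sum.inl γ → ∀ k, coeff 0 (U * shiftX Γ k V) = if k = 0 then c else 0) :
    dirCoef Γ * dirRes Γ U V c = U * miwaExt (dT ℂ Γ) V - C c := by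
  ext1 n
  rcases Γ with γ | γ
  · simp only [dirCoef, Sum.elim_inl, dirRes]
    rcases n with _ | n
    · have h0 := h γ rfl 0
      rw [shiftX_zero, if_pos rfl] at h0
      rw [map_sub, coeff_mul_miwaExt]
      simp [← h0]
    · rw [coeff_succ_X_mul, coeff_mk, shiftRes_zero, h γ rfl (n + 1), if_neg (by omega), map_sub,
        coeff_C, if_neg (by omega)]
  · simp only [dirCoef, Sum.elim_inr, dirRes, neg_mul, one_mul, map_neg, coeff_mk, map_sub,
      shiftRes_neg_one]
    ring

theorem sum_dir_eq {M : Type*} [AddCommMonoid M] (f : Dir N → M) (Γ : Dir N) :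
    ∑ Δ, f Δ = f Γ + f Γ.swap +
      ∑ δ ∈ univ.erase Γ.comp, (f (Sum.inl δ) + f (Sum.inr δ)) := by
  rw [Fintype.sum_sum_type, ← sum_add_distrib, ← add_sum_erase _ _ (mem_univ Γ.comp)]
  congr 1
  rcases Γ with γ | γ
  · rfl
  · exact add_comm _ _

theorem dirPow_of_ne {s s' : Fin N → ℤ} {δ : Fin N} (h : s' δ = s δ) :
    dirPow s s' (Sum.inl δ) = 0 ∧ dirPow s s' (Sum.inr δ) = -2 := by
  simp [dirPow, h]

theorem dirShift_of_ne {Γ : Dir N} {δ : Fin N} (h : δ ≠ Γ.comp) : dirShift Γ δ = 0 := by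
  rcases Γ with γ | γ
  · rfl
  · exact Pi.single_eq_of_ne h _

end Residues

end MultiToda

/-! ### Consequences of a single shift. -/

namespace MultiToda

open Finset PowerSeries

variable {N : ℕ}

theorem BilinearIdentity.sum_dirTerm {D : WaveData N} (hD : BilinearIdentity D)
    (s s' : Fin N → ℤ) (i j : Fin N) (Γ Γ' : Dir N) (n m : ℕ) :
    ∑ Δ, dirSign Δ • dirTerm Γ Γ' Δ (dirPow s s' Δ) (D.wav s i Δ) (D.adj s' Δ j) n m = 0 :=
  hD.shifted s s' i j Γ Γ' n m

theorem dschur_ite_one {A : Type*} [CommRing A] [Algebra ℂ A] (d : ℕ → Derivation ℂ A A)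
    (c : Prop) [Decidable c] (k : ℕ) :
    dschur d k (if c then 1 else 0) = if k = 0 then (if c then 1 else 0) else 0 := by
  rcases eq_or_ne k 0 with rfl | hk
  · simp
  · rw [if_neg hk]
    refine dschur_eq_zero (fun l => ?_) hk
    split_ifs <;> simp

theorem coeff_zero_mul {A : Type*} [CommRing A] (U W : A⟦X⟧) :
    coeff 0 (U * W) = coeff 0 U * coeff 0 W := by
  simp [coeff_mul]

theorem coeff_one_mul' {A : Type*} [CommRing A] (U W : A⟦X⟧) :
    coeff 1 (U * W) = coeff 0 U * coeff 1 W + coeff 1 U * coeff 0 W := by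
  rw [coeff_mul, Nat.sum_antidiagonal_succ]
  simp

namespace WaveData

variable (D : WaveData N)

theorem coeff_zero_wav (s : Fin N → ℤ) (i γ : Fin N) :
    coeff 0 (D.wav s i (Sum.inl γ)) = if i = γ then 1 else 0 := by
  rw [wav, coeff_mk, D.w_zero, Matrix.one_apply]

theorem coeff_zero_adj (s : Fin N → ℤ) (γ j : Fin N) :
    coeff 0 (D.adj s (Sum.inl γ) j) = if γ = j then 1 else 0 := by
  rw [adj, coeff_mk, D.wStar_zero, Matrix.one_apply]

theorem coeff_one_wav (s : Fin N → ℤ) (i γ : Fin N) :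
    coeff 1 (D.wav s i (Sum.inl γ)) = D.w s 1 i γ := by
  rw [wav, coeff_mk]

theorem coeff_one_adj (s : Fin N → ℤ) (γ j : Fin N) :
    coeff 1 (D.adj s (Sum.inl γ) j) = D.wStar s 1 γ j := by
  rw [adj, coeff_mk]

theorem coeff_zero_wav_mul (s s' : Fin N → ℤ) (i j α : Fin N) (Γ : Dir N) (k : ℕ) :
    coeff 0 (D.wav s i (Sum.inl α) * shiftX Γ k (D.adj s' (Sum.inl α) j)) =
      if k = 0 then unitEntry α i j else 0 := by
  rw [coeff_zero_mul, coeff_shiftX, coeff_zero_wav, coeff_zero_adj, dschur_ite_one]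
  simp only [unitEntry, eq_comm (a := α)]
  split_ifs <;> simp_all

theorem coeff_one_wav_mul (s s' : Fin N → ℤ) (i j δ : Fin N) (Γ Γ' : Dir N) (n m : ℕ) :
    coeff 1 (D.wav s i (Sum.inl δ) * shiftX Γ n (shiftX Γ' m (D.adj s' (Sum.inl δ) j))) =
      (if i = δ then dschur (dT ℂ Γ) n (dschur (dT ℂ Γ') m (D.wStar s' 1 δ j)) else 0) +
        if δ = j ∧ n = 0 ∧ m = 0 then D.w s 1 i δ else 0 := by
  rw [coeff_one_mul', coeff_shiftX, coeff_shiftX, coeff_shiftX, coeff_shiftX, coeff_zero_wav,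
    coeff_zero_adj, coeff_one_wav, coeff_one_adj, dschur_ite_one]
  rcases eq_or_ne m 0 with rfl | hm
  · rw [if_pos rfl, dschur_ite_one]
    split_ifs <;> simp_all
  · rw [if_neg hm, map_zero]
    split_ifs <;> simp_all

end WaveData

variable {D : WaveData N}

theorem BilinearIdentity.w_add_wStar (hD : BilinearIdentity D) (s : Fin N → ℤ) (i j : Fin N) :
    D.w s 1 i j + D.wStar s 1 i j = 0 := by
  have h := hD.shifted s s i j (Sum.inl i) (Sum.inl i) 0 0
  have h0 : ∀ Δ, dirPow s s Δ = Sum.elim (fun _ => 0) (fun _ => -2) Δ := by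
    intro Δ
    rcases Δ with δ | δ <;> simp [dirPow]
  simp only [Nat.antidiagonal_zero, sum_singleton, or_true, if_true, Nat.cast_zero, add_zero, h0,
    shiftX_zero] at h
  rw [Fintype.sum_sum_type] at h
  simp only [Sum.elim_inl, Sum.elim_inr, coeffShift_zero, coeffShift_neg_two, smul_zero,
    sum_const_zero, add_zero, dirSign, one_smul, coeff_one_mul', D.coeff_zero_wav,
    D.coeff_zero_adj, D.coeff_one_wav, D.coeff_one_adj, ite_mul, one_mul, zero_mul, mul_ite,
    mul_one, mul_zero, sum_add_distrib, sum_ite_eq, sum_ite_eq', mem_univ, if_true] at h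
  rw [add_comm, h]

/-- `s' = s + dirShift Γ` is chosen to make the powers of `z` small. An unbarred `Γ` has power `0`
and its conjugate `-2`, which contributes nothing; a barred `Γ` and its conjugate both have power
`-1`. Every other component gives only the first coefficient of its unbarred product. -/
theorem BilinearIdentity.one_shift (hD : BilinearIdentity D) (s : Fin N → ℤ) (i j : Fin N)
    (Γ : Dir N) :
    D.wav s i Γ * miwaExt (dT ℂ Γ) (D.adj (s + dirShift Γ) Γ j) - C (unitEntry Γ.comp i j) +
      dirCoef Γ * PowerSeries.mk (fun n => ∑ δ ∈ univ.erase Γ.comp, coeff 1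
        (D.wav s i (Sum.inl δ) * shiftX Γ n (D.adj (s + dirShift Γ) (Sum.inl δ) j))) = 0 := by
  rw [← dirCoef_mul_dirRes Γ _ _ (unitEntry Γ.comp i j), ← mul_add]
  · refine mul_eq_zero_of_right _ ?_
    ext1 n
    have h := hD.sum_dirTerm s (s + dirShift Γ) i j Γ Γ n 0
    rw [sum_dir_eq _ Γ] at h
    rw [map_add, coeff_mk, map_zero, ← h]
    congr 1
    · rw [dirTerm_zero_right]
      rcases Γ with γ | γ
      · rw [dirTerm_of_ne (by simp) (by simp)]
        simp [dirPow, dirSign, dirShift, dirRes, coeffShift_neg_two]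
      · rw [dirTerm_of_ne (by simp) (by simp)]
        have h1 : dirPow s (s + dirShift (Sum.inr γ)) (Sum.inr γ) = -1 := by
          simp [dirPow, dirShift]
        have h2 : dirPow s (s + dirShift (Sum.inr γ)) (Sum.inl γ) = -1 := by
          simp [dirPow, dirShift]
        rw [Sum.swap_inr, h1, h2, coeffShift_neg_one, shiftX_zero, D.coeff_zero_wav_mul, dirRes,
          coeff_mk, coeff_C]
        simp [dirSign, Dir.comp]
    · refine sum_congr rfl fun δ hδ => ?_
      have hδ' := ne_of_mem_erase hδ
      have hl : Γ ≠ Sum.inl δ := by rintro rfl; exact hδ' rfl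
      have hr : Γ ≠ Sum.inr δ := by rintro rfl; exact hδ' rfl
      have hp := dirPow_of_ne (s := s) (s' := s + dirShift Γ) (δ := δ)
        (by simp [dirShift_of_ne hδ'])
      rw [dirTerm_of_ne hl hl, dirTerm_of_ne hr hr, hp.1, hp.2, coeffShift_zero,
        coeffShift_neg_two]
      simp [dirSign]
  · rintro γ rfl k
    exact D.coeff_zero_wav_mul _ _ _ _ _ _ _

/-- The coefficients of the diagonal wave function of a family of times. -/
noncomputable def WaveData.diagWav (D : WaveData N) (s : Fin N → ℤ) (Γ : Dir N) :
    PowerSeries (TimeFun N) := D.wav s Γ.comp Γ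

/-- The coefficients of the shifted diagonal adjoint wave function of a family of times. -/
noncomputable def WaveData.diagAdj (D : WaveData N) (s : Fin N → ℤ) (Γ : Dir N) :
    PowerSeries (TimeFun N) := miwaExt (dT ℂ Γ) (D.adj (s + dirShift Γ) Γ Γ.comp)

/-- In the diagonal entry the other components drop out: their first coefficients carry an
off-diagonal entry of `w_0` or `w*_0`. For a barred family this makes the diagonal entry of `w̄_0` a
unit. -/
theorem BilinearIdentity.diagWav_mul_diagAdj (hD : BilinearIdentity D) (s : Fin N → ℤ)
    (Γ : Dir N) : D.diagWav s Γ * D.diagAdj s Γ = 1 := by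
  have h := hD.one_shift s Γ.comp Γ.comp Γ
  have h0 : (PowerSeries.mk fun n => ∑ δ ∈ univ.erase Γ.comp, coeff 1
      (D.wav s Γ.comp (Sum.inl δ) * shiftX Γ n (D.adj (s + dirShift Γ) (Sum.inl δ) Γ.comp))) =
      0 := by
    ext1 n
    rw [coeff_mk, map_zero]
    refine sum_eq_zero fun δ hδ => ?_
    have h := D.coeff_one_wav_mul s (s + dirShift Γ) Γ.comp Γ.comp δ Γ Γ n 0
    rw [shiftX_zero] at h
    rw [h, if_neg (ne_of_mem_erase hδ).symm, if_neg fun h => ne_of_mem_erase hδ h.1, add_zero]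
  rw [h0, mul_zero, add_zero, sub_eq_zero] at h
  rw [WaveData.diagWav, WaveData.diagAdj, h]
  simp [unitEntry]

theorem BilinearIdentity.isUnit_diagWav (hD : BilinearIdentity D) (s : Fin N → ℤ) (Γ : Dir N) :
    IsUnit (D.diagWav s Γ) :=
  IsUnit.of_mul_eq_one _ (hD.diagWav_mul_diagAdj s Γ)

/-- In the entry `(i, Γ.comp)` of `one_shift` only the component `i` survives, with the shifted
`w*_1 = -w_1`. This suggests `w_{1,αβ} τ` as the off-diagonal tau function. -/
theorem BilinearIdentity.wav_eq (hD : BilinearIdentity D) (s : Fin N → ℤ) {i : Fin N}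
    {Γ : Dir N} (hi : i ≠ Γ.comp) :
    D.wav s i Γ = dirCoef Γ * miwa (dT ℂ Γ) (D.w (s + dirShift Γ) 1 i Γ.comp) * D.diagWav s Γ := by
  have h := hD.one_shift s i Γ.comp Γ
  have h0 : (PowerSeries.mk fun n => ∑ δ ∈ univ.erase Γ.comp, coeff 1
      (D.wav s i (Sum.inl δ) * shiftX Γ n (D.adj (s + dirShift Γ) (Sum.inl δ) Γ.comp))) =
      -miwa (dT ℂ Γ) (D.w (s + dirShift Γ) 1 i Γ.comp) := by
    ext1 n
    rw [coeff_mk, map_neg, coeff_miwa, sum_eq_single i]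
    · have h := D.coeff_one_wav_mul s (s + dirShift Γ) i Γ.comp i Γ Γ n 0
      rw [shiftX_zero] at h
      rw [h, if_pos rfl, if_neg fun h => hi h.1, add_zero, dschur_zero, ← map_neg,
        eq_neg_of_add_eq_zero_left (hD.w_add_wStar _ _ _), neg_neg]
    · intro δ hδ hne
      have h := D.coeff_one_wav_mul s (s + dirShift Γ) i Γ.comp δ Γ Γ n 0
      rw [shiftX_zero] at h
      rw [h, if_neg hne.symm, if_neg fun h => ne_of_mem_erase hδ h.1, add_zero]
    · intro h
      exact absurd (mem_erase.2 ⟨hi, mem_univ _⟩) h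
  have hu : unitEntry (A := TimeFun N) Γ.comp i Γ.comp = 0 := if_neg fun h => hi h.1
  rw [h0, hu, map_zero, sub_zero] at h
  change _ * D.diagAdj s Γ + _ = 0 at h
  linear_combination D.diagWav s Γ * h - D.wav s i Γ * hD.diagWav_mul_diagAdj s Γ

/-- Now the surviving component is `j`, and its `w_1` belongs to the unshifted wave function; hence
a constant in `a`, at `s` rather than at `s + dirShift Γ`. -/
theorem BilinearIdentity.diagWav_mul_adj (hD : BilinearIdentity D) (s : Fin N → ℤ) {j : Fin N}
    {Γ : Dir N} (hj : j ≠ Γ.comp) :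
    D.diagWav s Γ * miwaExt (dT ℂ Γ) (D.adj (s + dirShift Γ) Γ j) =
      -(dirCoef Γ * C (D.w s 1 Γ.comp j)) := by
  have h := hD.one_shift s Γ.comp j Γ
  have h0 : (PowerSeries.mk fun n => ∑ δ ∈ univ.erase Γ.comp, coeff 1
      (D.wav s Γ.comp (Sum.inl δ) * shiftX Γ n (D.adj (s + dirShift Γ) (Sum.inl δ) j))) =
      C (D.w s 1 Γ.comp j) := by
    ext1 n
    rw [coeff_mk, coeff_C, sum_eq_single j]
    · have h := D.coeff_one_wav_mul s (s + dirShift Γ) Γ.comp j j Γ Γ n 0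
      rw [shiftX_zero] at h
      rw [h, if_neg hj.symm, zero_add]
      simp
    · intro δ hδ hne
      have h := D.coeff_one_wav_mul s (s + dirShift Γ) Γ.comp j δ Γ Γ n 0
      rw [shiftX_zero] at h
      rw [h, if_neg (ne_of_mem_erase hδ).symm, if_neg fun h => hne h.1, add_zero]
    · intro h
      exact absurd (mem_erase.2 ⟨hj, mem_univ _⟩) h
  have hu : unitEntry (A := TimeFun N) Γ.comp Γ.comp j = 0 := if_neg fun h => hj h.2
  rw [h0, hu, map_zero, sub_zero] at h
  exact eq_neg_of_add_eq_zero_left h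

end MultiToda

/-! ### Two simultaneous shifts and the cocycle relation. -/

namespace MultiToda

open Finset PowerSeries

/-- With `F(x) = ∑ e k i j x^k a^i b^j`, the hypothesis says `(F(a) - F(b)) / (a - b) = 0` and the
conclusion says `F(a) = F(b)`. Multiplying by `a - b` means comparing the hypothesis at `(n, m + 1)`
and at `(n + 1, m)`. -/
theorem sum_antidiagonal_symm_of_sum_eq_zero {M : Type*} [AddCommGroup M] (e : ℕ → ℕ → ℕ → M)
    (h : ∀ n m, ∑ b ∈ antidiagonal m, ∑ a ∈ antidiagonal n, e (a.1 + b.1 + 1) a.2 b.2 = 0)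
    (n m : ℕ) :
    ∑ a ∈ antidiagonal n, e a.1 a.2 m = ∑ b ∈ antidiagonal m, e b.1 n b.2 := by
  rcases n with _ | n <;> rcases m with _ | m
  · simp
  · have := h 0 m
    simp only [Nat.antidiagonal_zero, sum_singleton, zero_add] at this
    simp [Nat.sum_antidiagonal_succ, this]
  · have := h n 0
    simp only [Nat.antidiagonal_zero, sum_singleton, add_zero] at this
    simp [Nat.sum_antidiagonal_succ, this]
  · have h1 := h n (m + 1)
    have h2 := h (n + 1) m
    rw [Nat.sum_antidiagonal_succ] at h1
    simp only [Nat.sum_antidiagonal_succ, sum_add_distrib] at h2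
    rw [Nat.sum_antidiagonal_succ, Nat.sum_antidiagonal_succ, add_right_inj]
    simp only [add_zero, zero_add] at h1 h2
    have h3 : ∀ a b : ℕ × ℕ, a.1 + (b.1 + 1) + 1 = a.1 + 1 + b.1 + 1 := fun a b => by omega
    simp only [h3] at h1
    rw [eq_neg_of_add_eq_zero_left h1, eq_neg_of_add_eq_zero_left h2]

variable {N : ℕ}

theorem shiftX_miwaExt (Γ Γ' : Dir N) (m : ℕ) (V : PowerSeries (TimeFun N)) :
    shiftX Γ' m (miwaExt (dT ℂ Γ) V) = miwaExt (dT ℂ Γ) (shiftX Γ' m V) := by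
  ext1 n
  rw [coeff_shiftX, coeff_miwaExt, coeff_miwaExt, map_sum]
  refine sum_congr rfl fun p _ => ?_
  rw [coeff_shiftX, dschur_comm fun k l f => dT_comm ℂ Γ' Γ k l f]

/-- The product of `U` and of `V` shifted in the families `Γ` (inner) and `Γ'` (outer). -/
noncomputable def innerProd (Γ Γ' : Dir N) (U V : PowerSeries (TimeFun N)) :
    PowerSeries (PowerSeries (TimeFun N)) :=
  C U * miwa (fun k => extD (dT ℂ Γ' k)) (miwaExt (dT ℂ Γ) V)

/-- The product of `U` in the outer variable and of `V` shifted in the families `Γ` (inner)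
and `Γ'` (outer). -/
noncomputable def outerProd (Γ Γ' : Dir N) (U V : PowerSeries (TimeFun N)) :
    PowerSeries (PowerSeries (TimeFun N)) :=
  PowerSeries.map C U * PowerSeries.map (miwa (dT ℂ Γ)) (miwaExt (dT ℂ Γ') V)

theorem coeff_innerProd (Γ Γ' : Dir N) (U V : PowerSeries (TimeFun N)) (m : ℕ) :
    coeff m (innerProd Γ Γ' U V) = U * miwaExt (dT ℂ Γ) (shiftX Γ' m V) := by
  rw [innerProd, coeff_C_mul, coeff_miwa, ← shiftX_miwaExt]
  rfl

theorem coeff_coeff_map_C_mul {A : Type*} [CommRing A] (K : A⟦X⟧) (G : A⟦X⟧⟦X⟧) (n m : ℕ) :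
    coeff n (coeff m (PowerSeries.map C K * G)) =
      coeff m (K * PowerSeries.mk fun m => coeff n (coeff m G)) := by
  simp [coeff_mul m]

theorem coeff_coeff_outerProd (Γ Γ' : Dir N) (U V : PowerSeries (TimeFun N)) (n m : ℕ) :
    coeff n (coeff m (outerProd Γ Γ' U V)) =
      coeff m (U * miwaExt (dT ℂ Γ') (shiftX Γ n V)) := by
  rw [outerProd, coeff_coeff_map_C_mul]
  congr 2
  ext1 k
  rw [coeff_mk, coeff_map, coeff_miwa, ← shiftX_miwaExt, coeff_shiftX]

theorem dirTerm_symm (Γ Γ' Δ : Dir N) (p : ℤ) (U V : PowerSeries (TimeFun N)) (n m : ℕ) :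
    dirTerm Γ Γ' Δ p U V n m = dirTerm Γ' Γ Δ p U V m n := by
  simp only [dirTerm]
  have h : ∀ (c : Prop) [Decidable c] (g : ℕ × ℕ → TimeFun N) (n : ℕ),
      (if c then ∑ a ∈ antidiagonal n, g a else 0) =
        ∑ a ∈ antidiagonal n, if c then g a else 0 := by
    intro c _ g n
    split_ifs <;> simp
  simp only [h]
  rw [sum_comm]
  refine sum_congr rfl fun a _ => sum_congr rfl fun b _ => ?_
  rw [shiftX_comm Γ Γ', add_right_comm]
  split_ifs <;> rfl

theorem map_miwa_dirCoef (d : ℕ → Derivation ℂ (TimeFun N) (TimeFun N)) (Γ : Dir N) :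
    PowerSeries.map (miwa d) (dirCoef Γ) = PowerSeries.map C (dirCoef Γ) := by
  rcases Γ with γ | γ <;> simp [dirCoef]

theorem miwa_ext_dirCoef (d : ℕ → Derivation ℂ (TimeFun N) (TimeFun N)) (Γ : Dir N) :
    miwa (fun k => extD (d k)) (dirCoef Γ) = C (dirCoef Γ) := by
  rcases Γ with γ | γ
  · ext1 n
    rw [coeff_miwa, coeff_C]
    split_ifs with h
    · subst h
      simp
    · refine dschur_eq_zero (fun k => ?_) h
      ext1 l
      rw [coeff_extD, dirCoef, Sum.elim_inl, coeff_X]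
      split_ifs <;> simp
  · simp [dirCoef]

theorem miwa_ext_C {A : Type*} [CommRing A] [Algebra ℂ A] (d : ℕ → Derivation ℂ A A) (f : A) :
    miwa (fun k => extD (d k)) (C f) = PowerSeries.map C (miwa d f) := by
  ext1 n
  rw [coeff_miwa, coeff_map, coeff_miwa]
  ext1 k
  rw [coeff_dschur_extD, coeff_C, coeff_C]
  split_ifs <;> simp

theorem dirCoef_ne_zero (Γ : Dir N) : dirCoef Γ ≠ 0 := by
  rcases Γ with γ | γ
  · exact X_ne_zero
  · exact neg_ne_zero.2 one_ne_zero

variable {D : WaveData N}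

theorem WaveData.coeff_zero_wav_mul_mul (D : WaveData N) (s s' : Fin N → ℤ) (i j α : Fin N)
    (Γ Γ' : Dir N) (k l : ℕ) :
    coeff 0 (D.wav s i (Sum.inl α) * shiftX Γ k (shiftX Γ' l (D.adj s' (Sum.inl α) j))) =
      if k = 0 then (if l = 0 then unitEntry α i j else 0) else 0 := by
  rw [coeff_zero_mul, coeff_shiftX, coeff_shiftX, D.coeff_zero_wav, D.coeff_zero_adj,
    dschur_ite_one]
  rcases eq_or_ne l 0 with rfl | hl
  · rw [if_pos rfl, dschur_ite_one]
    simp only [unitEntry, eq_comm (a := α)]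
    split_ifs <;> simp_all
  · rw [if_neg hl, map_zero]
    simp [hl]

/-- The contribution to the bilinear identity of the two families of a component. -/
theorem WaveData.dirTerm_add_swap (D : WaveData N) {s s' : Fin N → ℤ} {Γ Γ' : Dir N}
    (hΓ : Γ'.comp ≠ Γ.comp) (hs : s' Γ.comp = s Γ.comp + dirShift Γ Γ.comp) (i j : Fin N)
    (n m : ℕ) :
    dirSign Γ • dirTerm Γ Γ' Γ (dirPow s s' Γ) (D.wav s i Γ) (D.adj s' Γ j) n m +
      dirSign Γ.swap • dirTerm Γ Γ' Γ.swap (dirPow s s' Γ.swap) (D.wav s i Γ.swap)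
        (D.adj s' Γ.swap j) n m =
      coeff n (dirRes Γ (D.wav s i Γ) (shiftX Γ' m (D.adj s' Γ j))
        (if m = 0 then unitEntry Γ.comp i j else 0)) := by
  have h1 : Γ' ≠ Γ := by rintro rfl; exact hΓ rfl
  rw [dirTerm_left h1]
  rcases Γ with γ | γ
  · have h2 : Γ' ≠ Sum.inr γ := by rintro rfl; exact hΓ rfl
    rw [Sum.swap_inl, dirTerm_of_ne (by simp) h2]
    simp only [Dir.comp, Sum.elim_inl, dirShift, id] at hs
    simp [dirPow, dirSign, dirRes, hs, coeffShift_neg_two]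
  · have h2 : Γ' ≠ Sum.inl γ := by rintro rfl; exact hΓ rfl
    rw [Sum.swap_inr, dirTerm_of_ne (by simp) h2]
    simp only [Dir.comp, Sum.elim_inr, dirShift, id, Pi.single_eq_same] at hs
    have h3 : dirPow s s' (Sum.inr γ) = -1 := by simp [dirPow, hs]
    have h4 : dirPow s s' (Sum.inl γ) = -1 := by simp [dirPow, hs]
    rw [h3, h4, coeffShift_neg_one, D.coeff_zero_wav_mul_mul, dirRes, coeff_mk, coeff_C]
    simp [dirSign, Dir.comp]

/-- Components outside both shifts contribute nothing if `i` and `j` avoid them: the barred power is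
`-2`, and the first coefficient of the unbarred product needs `i = δ` or `j = δ`. -/
theorem WaveData.dirTerm_add_of_ne (D : WaveData N) {s s' : Fin N → ℤ} {Γ Γ' : Dir N} {δ : Fin N}
    (hΓ : δ ≠ Γ.comp) (hΓ' : δ ≠ Γ'.comp) (hs : s' δ = s δ) {i j : Fin N} (hi : i ≠ δ)
    (hj : j ≠ δ) (n m : ℕ) :
    dirSign (Sum.inl δ) • dirTerm Γ Γ' (Sum.inl δ) (dirPow s s' (Sum.inl δ))
        (D.wav s i (Sum.inl δ)) (D.adj s' (Sum.inl δ) j) n m +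
      dirSign (Sum.inr δ) • dirTerm Γ Γ' (Sum.inr δ) (dirPow s s' (Sum.inr δ))
        (D.wav s i (Sum.inr δ)) (D.adj s' (Sum.inr δ) j) n m = 0 := by
  have hl : ∀ {Γ : Dir N}, δ ≠ Γ.comp → Γ ≠ Sum.inl δ := by rintro _ h rfl; exact h rfl
  have hr : ∀ {Γ : Dir N}, δ ≠ Γ.comp → Γ ≠ Sum.inr δ := by rintro _ h rfl; exact h rfl
  have hp := dirPow_of_ne hs
  rw [dirTerm_of_ne (hl hΓ) (hl hΓ'), dirTerm_of_ne (hr hΓ) (hr hΓ'), hp.1, hp.2, coeffShift_zero,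
    coeffShift_neg_two, D.coeff_one_wav_mul, if_neg hi, if_neg fun h => hj h.1.symm]
  simp

theorem innerProd_eq_outerProd_iff {Γ Γ' : Dir N} {U V U' V' : PowerSeries (TimeFun N)} :
    innerProd Γ Γ' U V = outerProd Γ Γ' U' V' ↔ ∀ n m,
      coeff n (U * miwaExt (dT ℂ Γ) (shiftX Γ' m V)) =
        coeff m (U' * miwaExt (dT ℂ Γ') (shiftX Γ n V')) := by
  simp only [PowerSeries.ext_iff, coeff_innerProd, coeff_coeff_outerProd]
  exact forall_comm

/-- Both shifts in one family give the kernel `1/((1 - a z)(1 - b z))` with power `0`; the conjugate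
family has power `-2` and vanishes. The residue is the divided difference of the product at `a` and
`b`, so the two values agree. -/
theorem BilinearIdentity.innerProd_self (hD : BilinearIdentity D) (s : Fin N → ℤ) (Γ : Dir N) :
    innerProd Γ Γ (D.diagWav s Γ) (D.adj (s + dirShift Γ + dirShift Γ) Γ Γ.comp) =
      outerProd Γ Γ (D.diagWav s Γ) (D.adj (s + dirShift Γ + dirShift Γ) Γ Γ.comp) := by
  rw [innerProd_eq_outerProd_iff]
  set V := D.adj (s + dirShift Γ + dirShift Γ) Γ Γ.comp with hV
  intro n m
  simp only [coeff_mul_miwaExt]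
  have := sum_antidiagonal_symm_of_sum_eq_zero
    (fun k a b => coeff k (D.diagWav s Γ * shiftX Γ a (shiftX Γ b V))) (fun n m => ?_) n m
  · rw [this]
    exact sum_congr rfl fun b _ => by rw [shiftX_comm]
  have h := hD.sum_dirTerm s (s + dirShift Γ + dirShift Γ) Γ.comp Γ.comp Γ Γ n m
  rw [sum_dir_eq _ Γ, sum_eq_zero, add_zero] at h
  · have h1 : dirTerm Γ Γ Γ.swap (dirPow s (s + dirShift Γ + dirShift Γ) Γ.swap)
        (D.wav s Γ.comp Γ.swap) (D.adj (s + dirShift Γ + dirShift Γ) Γ.swap Γ.comp) n m = 0 := by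
      have hne : Γ ≠ Γ.swap := by rcases Γ with γ | γ <;> simp
      have hp : dirPow s (s + dirShift Γ + dirShift Γ) Γ.swap = -2 := by
        rcases Γ with γ | γ <;> simp [dirPow, dirShift]
        ring
      rw [dirTerm_of_ne hne hne, hp, coeffShift_neg_two]
    have hp : dirPow s (s + dirShift Γ + dirShift Γ) Γ = 0 := by
      rcases Γ with γ | γ <;> simp [dirPow, dirShift]
      ring
    have hs : dirSign Γ = 1 ∨ dirSign Γ = -1 := by
      rcases Γ with γ | γ <;> simp [dirSign]
    have h2 : dirTerm Γ Γ Γ 0 (D.diagWav s Γ) V n m = 0 := by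
      rw [h1, smul_zero, add_zero, hp] at h
      rcases hs with hs | hs <;> rw [hs] at h
      · rwa [one_smul] at h
      · rwa [neg_smul, one_smul, neg_eq_zero] at h
    rw [dirTerm] at h2
    simp only [true_or, if_true] at h2
    rw [← h2]
    refine sum_congr rfl fun b _ => sum_congr rfl fun a _ => ?_
    rw [← coeffShift_natCast]
    congr 1
    push_cast
    ring
  · intro δ hδ
    have hδ' := ne_of_mem_erase hδ
    exact D.dirTerm_add_of_ne hδ' hδ' (by simp [dirShift_of_ne hδ']) hδ'.symm hδ'.symm n m

/-- For conjugate families both powers are `-1`, so each residue is an evaluation, one at `a` and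
one at `b`; the opposite signs equate them. -/
theorem BilinearIdentity.innerProd_swap (hD : BilinearIdentity D) (s : Fin N → ℤ) (Γ : Dir N) :
    innerProd Γ Γ.swap (D.diagWav s Γ) (D.adj (s + dirShift Γ + dirShift Γ.swap) Γ Γ.comp) =
      outerProd Γ Γ.swap (D.diagWav s Γ.swap)
        (D.adj (s + dirShift Γ + dirShift Γ.swap) Γ.swap Γ.comp) := by
  rw [innerProd_eq_outerProd_iff]
  intro n m
  have hc : Dir.comp Γ.swap = Γ.comp := by rcases Γ with γ | γ <;> rfl
  have hne : Γ ≠ Γ.swap := by rcases Γ with γ | γ <;> simp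
  have h := hD.sum_dirTerm s (s + dirShift Γ + dirShift Γ.swap) Γ.comp Γ.comp Γ Γ.swap n m
  rw [sum_dir_eq _ Γ, sum_eq_zero, add_zero, dirTerm_left hne.symm, dirTerm_right hne] at h
  · have h1 : dirPow s (s + dirShift Γ + dirShift Γ.swap) Γ = -1 := by
      rcases Γ with γ | γ <;> simp [dirPow, dirShift]
    have h2 : dirPow s (s + dirShift Γ + dirShift Γ.swap) Γ.swap = -1 := by
      rcases Γ with γ | γ <;> simp [dirPow, dirShift]
    rw [h1, h2, shiftRes_neg_one, shiftRes_neg_one] at h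
    rw [WaveData.diagWav, WaveData.diagWav, hc]
    rcases Γ with γ | γ
    · simpa [dirSign, add_neg_eq_zero] using h
    · simpa [dirSign, neg_add_eq_zero] using h
  · intro δ hδ
    have hδ' := ne_of_mem_erase hδ
    exact D.dirTerm_add_of_ne hδ' (hc ▸ hδ')
      (by simp [dirShift_of_ne hδ', dirShift_of_ne (Γ := Γ.swap) (hc ▸ hδ')])
      hδ'.symm hδ'.symm n m

/-- Each of the two components yields a `dirRes` in its own variable; multiplying the identity by
both `dirCoef` factors turns these into products of values. The restriction on `i` and `j` removes
all other components. -/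
theorem BilinearIdentity.two_shift (hD : BilinearIdentity D) (s : Fin N → ℤ) {Γ Γ' : Dir N}
    (hne : Γ.comp ≠ Γ'.comp) {i j : Fin N} (hi : i = Γ.comp ∨ i = Γ'.comp)
    (hj : j = Γ.comp ∨ j = Γ'.comp) :
    PowerSeries.map C (dirCoef Γ') * (innerProd Γ Γ' (D.wav s i Γ)
        (D.adj (s + dirShift Γ + dirShift Γ') Γ j) - C (C (unitEntry Γ.comp i j))) +
      C (dirCoef Γ) * (outerProd Γ Γ' (D.wav s i Γ')
        (D.adj (s + dirShift Γ + dirShift Γ') Γ' j) - C (C (unitEntry Γ'.comp i j))) = 0 := by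
  set s' := s + dirShift Γ + dirShift Γ' with hs'
  set g : ℕ → PowerSeries (TimeFun N) := fun m => dirRes Γ (D.wav s i Γ)
    (shiftX Γ' m (D.adj s' Γ j)) (if m = 0 then unitEntry Γ.comp i j else 0) with hg
  set g' : ℕ → PowerSeries (TimeFun N) := fun n => dirRes Γ' (D.wav s i Γ')
    (shiftX Γ n (D.adj s' Γ' j)) (if n = 0 then unitEntry Γ'.comp i j else 0) with hg'
  have key : ∀ n m, coeff n (g m) + coeff m (g' n) = 0 := by
    intro n m
    have h := hD.sum_dirTerm s s' i j Γ Γ' n m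
    rw [sum_dir_eq _ Γ, sum_eq_single Γ'.comp] at h
    · rw [D.dirTerm_add_swap hne.symm (by simp [hs', dirShift_of_ne hne])] at h
      have h2 := D.dirTerm_add_swap (s := s) (s' := s') (Γ := Γ') (Γ' := Γ) hne
        (by simp [hs', dirShift_of_ne hne.symm]) i j m n
      rw [dirTerm_symm, dirTerm_symm Γ' Γ] at h2
      rw [← h, ← h2]
      congr 1
      rcases Γ' with γ | γ
      · rfl
      · exact add_comm _ _
    · intro δ hδ hδ2
      have hδ' := ne_of_mem_erase hδ
      refine D.dirTerm_add_of_ne hδ' hδ2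
        (by simp [hs', dirShift_of_ne hδ', dirShift_of_ne hδ2]) ?_ ?_ n m
      · rcases hi with rfl | rfl
        · exact hδ'.symm
        · exact hδ2.symm
      · rcases hj with rfl | rfl
        · exact hδ'.symm
        · exact hδ2.symm
    · intro h
      exact absurd (mem_erase.2 ⟨hne.symm, mem_univ _⟩) h
  set G : PowerSeries (PowerSeries (TimeFun N)) := PowerSeries.mk g with hG
  set G' : PowerSeries (PowerSeries (TimeFun N)) :=
    PowerSeries.mk fun m => PowerSeries.mk fun n => coeff m (g' n) with hG'
  have h0 : G + G' = 0 := by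
    ext1 m
    ext1 n
    simpa [hG, hG'] using key n m
  have h1 : innerProd Γ Γ' (D.wav s i Γ) (D.adj s' Γ j) - C (C (unitEntry Γ.comp i j)) =
      C (dirCoef Γ) * G := by
    ext1 m
    rw [coeff_C_mul, hG, coeff_mk, hg, dirCoef_mul_dirRes, map_sub, coeff_innerProd, coeff_C]
    · split_ifs <;> simp
    · rintro γ rfl k
      exact D.coeff_zero_wav_mul_mul _ _ _ _ _ _ _ _ _
  have h2 : outerProd Γ Γ' (D.wav s i Γ') (D.adj s' Γ' j) - C (C (unitEntry Γ'.comp i j)) =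
      PowerSeries.map C (dirCoef Γ') * G' := by
    ext1 m
    ext1 n
    -- The series `g' n` is in the outer variable, so the coefficients of `G'` are read with the
    -- inner index fixed.
    have h3 : (PowerSeries.mk fun m => coeff n (coeff m G')) = g' n := by
      ext1 m
      simp [hG']
    rw [coeff_coeff_map_C_mul, h3, hg', dirCoef_mul_dirRes, map_sub, map_sub, map_sub,
      coeff_coeff_outerProd, coeff_C, coeff_C]
    · rcases eq_or_ne m 0 with rfl | hm
      · simp [coeff_C]
      · simp [hm]
    · rintro γ rfl k
      exact D.coeff_zero_wav_mul_mul _ _ _ _ _ _ _ _ _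
  rw [h1, h2]
  linear_combination PowerSeries.map C (dirCoef Γ') * C (dirCoef Γ) * h0

theorem innerProd_mul_left (Γ Γ' : Dir N) (K U V : PowerSeries (TimeFun N)) :
    innerProd Γ Γ' (K * U) V = C K * innerProd Γ Γ' U V := by
  rw [innerProd, innerProd, map_mul, mul_assoc]

theorem outerProd_mul_left (Γ Γ' : Dir N) (K U V : PowerSeries (TimeFun N)) :
    outerProd Γ Γ' (K * U) V = PowerSeries.map C K * outerProd Γ Γ' U V := by
  rw [outerProd, outerProd, map_mul, mul_assoc]

theorem BilinearIdentity.miwaExt_adj (hD : BilinearIdentity D) (s : Fin N → ℤ) {j : Fin N}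
    {Γ : Dir N} (hj : j ≠ Γ.comp) :
    miwaExt (dT ℂ Γ) (D.adj (s + dirShift Γ) Γ j) =
      -(dirCoef Γ * C (D.w s 1 Γ.comp j)) * D.diagAdj s Γ := by
  linear_combination D.diagAdj s Γ * hD.diagWav_mul_adj s hj -
    miwaExt (dT ℂ Γ) (D.adj (s + dirShift Γ) Γ j) * hD.diagWav_mul_diagAdj s Γ

/-- For distinct components `two_shift` also contains off-diagonal functions. By `wav_eq` and
`miwaExt_adj` these are multiples of the diagonal ones, so three of its entries become relations
between the two diagonal products `P` and `Q`. -/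
theorem BilinearIdentity.innerProd_eq_outerProd_of_comp_ne (hD : BilinearIdentity D)
    (s : Fin N → ℤ) {Γ Γ' : Dir N} (hne : Γ.comp ≠ Γ'.comp) :
    innerProd Γ Γ' (D.diagWav s Γ) (D.adj (s + dirShift Γ + dirShift Γ') Γ Γ.comp) =
      outerProd Γ Γ' (D.diagWav s Γ') (D.adj (s + dirShift Γ + dirShift Γ') Γ' Γ'.comp) := by
  have hαα := hD.two_shift s hne (Or.inl rfl) (Or.inl rfl)
  have hαβ := hD.two_shift s hne (Or.inl rfl) (Or.inr rfl)
  have hββ := hD.two_shift s hne (Or.inr rfl) (Or.inr rfl)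
  have hs : s + dirShift Γ + dirShift Γ' = s + dirShift Γ' + dirShift Γ := add_right_comm _ _ _
  set s' := s + dirShift Γ + dirShift Γ' with hs'
  set B := PowerSeries.map C (dirCoef Γ') with hB
  set A := (C (dirCoef Γ) : PowerSeries (PowerSeries (TimeFun N))) with hA
  have hA0 : A ≠ 0 := fun h => dirCoef_ne_zero Γ (C_injective (h.trans (map_zero C).symm))
  have hB0 : B ≠ 0 := fun h => dirCoef_ne_zero Γ' (by
    ext1 k
    have := congrArg (fun F => coeff 0 (coeff k F)) h
    simpa [hB] using this)
  set u := PowerSeries.map C (miwa (dT ℂ Γ') (D.w (s + dirShift Γ') 1 Γ.comp Γ'.comp)) with hu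
  set v := (C (miwa (dT ℂ Γ) (D.w (s + dirShift Γ) 1 Γ'.comp Γ.comp)) :
    PowerSeries (PowerSeries (TimeFun N))) with hv
  have hE : ∀ U, innerProd Γ Γ' U (D.adj s' Γ Γ'.comp) =
      -(A * u) * innerProd Γ Γ' U (D.adj s' Γ Γ.comp) := by
    intro U
    rw [innerProd, innerProd, hs, hD.miwaExt_adj _ hne.symm, map_mul, map_neg, map_mul,
      miwa_ext_dirCoef, miwa_ext_C, WaveData.diagAdj]
    ring
  have hE' : ∀ U, outerProd Γ Γ' U (D.adj s' Γ' Γ.comp) =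
      -(B * v) * outerProd Γ Γ' U (D.adj s' Γ' Γ'.comp) := by
    intro U
    rw [outerProd, outerProd, hs', hD.miwaExt_adj _ hne, map_mul, map_neg, map_mul,
      map_miwa_dirCoef, PowerSeries.map_C, WaveData.diagAdj]
    ring
  have e1 : unitEntry (A := TimeFun N) Γ.comp Γ.comp Γ'.comp = 0 := if_neg fun h => hne h.2.symm
  have e2 : unitEntry (A := TimeFun N) Γ'.comp Γ.comp Γ'.comp = 0 := if_neg fun h => hne h.1
  have e3 : unitEntry (A := TimeFun N) Γ'.comp Γ.comp Γ.comp = 0 := if_neg fun h => hne h.1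
  have e4 : unitEntry (A := TimeFun N) Γ.comp Γ'.comp Γ'.comp = 0 :=
    if_neg fun h => hne h.1.symm
  have e5 : unitEntry (A := TimeFun N) Γ.comp Γ.comp Γ.comp = 1 := if_pos ⟨rfl, rfl⟩
  have e6 : unitEntry (A := TimeFun N) Γ'.comp Γ'.comp Γ'.comp = 1 := if_pos ⟨rfl, rfl⟩
  rw [hD.wav_eq s hne, mul_assoc, outerProd_mul_left, outerProd_mul_left, e3, e5, hE'] at hαα
  rw [hD.wav_eq s hne, mul_assoc, outerProd_mul_left, outerProd_mul_left, e1, e2, hE] at hαβ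
  rw [hD.wav_eq s hne.symm, mul_assoc, innerProd_mul_left, innerProd_mul_left, e4, e6, hE] at hββ
  change B * (innerProd Γ Γ' (D.diagWav s Γ) (D.adj s' Γ Γ.comp) - _) + _ = 0 at hαα
  change B * (_ * innerProd Γ Γ' (D.diagWav s Γ) (D.adj s' Γ Γ.comp) - _) + _ = 0 at hαβ
  change _ + A * (outerProd Γ Γ' (D.diagWav s Γ') (D.adj s' Γ' Γ'.comp) - _) = 0 at hββ
  set P := innerProd Γ Γ' (D.diagWav s Γ) (D.adj s' Γ Γ.comp)
  set Q := outerProd Γ Γ' (D.diagWav s Γ') (D.adj s' Γ' Γ'.comp)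
  simp only [map_zero, map_one, sub_zero] at hαα hαβ hββ
  -- Only `A` and `B` may be cancelled, since `u` and `v` can vanish. The relation `u Q = u P` is
  -- enough: the difference `P - Q = A B u v (Q - P)` contains the factor `u`.
  have h1 : P - 1 = A * B * u * v * Q := mul_left_cancel₀ hB0 (by linear_combination hαα)
  have h2 : Q - 1 = A * B * u * v * P := mul_left_cancel₀ hA0 (by linear_combination hββ)
  have h3 : u * Q = u * P :=
    mul_left_cancel₀ (mul_ne_zero hA0 hB0) (by linear_combination hαβ)
  linear_combination h1 - h2 + A * B * v * h3

/-- Compatibility of the diagonal wave functions of two families of times. -/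
theorem BilinearIdentity.cocycle (hD : BilinearIdentity D) (s : Fin N → ℤ) (Γ Γ' : Dir N) :
    C (D.diagWav s Γ) * PowerSeries.map (miwa (dT ℂ Γ)) (D.diagWav (s + dirShift Γ) Γ') =
      PowerSeries.map C (D.diagWav s Γ') *
        miwa (fun k => extD (dT ℂ Γ' k)) (D.diagWav (s + dirShift Γ') Γ) := by
  have key : innerProd Γ Γ' (D.diagWav s Γ) (D.adj (s + dirShift Γ + dirShift Γ') Γ Γ.comp) =
      outerProd Γ Γ' (D.diagWav s Γ')
        (D.adj (s + dirShift Γ + dirShift Γ') Γ' Γ'.comp) := by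
    by_cases hc : Γ.comp = Γ'.comp
    · have : Γ' = Γ ∨ Γ' = Γ.swap := by
        rcases Γ with γ | γ <;> rcases Γ' with γ' | γ' <;> simp [Dir.comp] at hc ⊢ <;> exact hc.symm
      rcases this with rfl | rfl
      · exact hD.innerProd_self s _
      · rw [hD.innerProd_swap, hc]
    · exact hD.innerProd_eq_outerProd_of_comp_ne s hc
  rw [innerProd, outerProd, ← WaveData.diagAdj] at key
  rw [add_right_comm, ← WaveData.diagAdj] at key
  -- The adjoint functions in `key` are shifted inverses of diagonal wave functions; clearing them
  -- by multiplication gives the cocycle relation.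
  have h1 := congrArg (PowerSeries.map (miwa (dT ℂ Γ)))
    (hD.diagWav_mul_diagAdj (s + dirShift Γ) Γ')
  have h2 := congrArg (miwa (fun k => extD (dT ℂ Γ' k)))
    (hD.diagWav_mul_diagAdj (s + dirShift Γ') Γ)
  rw [map_mul, map_one] at h1 h2
  linear_combination (PowerSeries.map (miwa (dT ℂ Γ)) (D.diagWav (s + dirShift Γ) Γ') *
    miwa (fun k => extD (dT ℂ Γ' k)) (D.diagWav (s + dirShift Γ') Γ)) * key -
    C (D.diagWav s Γ) * PowerSeries.map (miwa (dT ℂ Γ)) (D.diagWav (s + dirShift Γ) Γ') * h2 +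
    PowerSeries.map C (D.diagWav s Γ') *
      miwa (fun k => extD (dT ℂ Γ' k)) (D.diagWav (s + dirShift Γ') Γ) * h1

end MultiToda

/-! ### Lattice cocycles and the scalar tau function. -/

namespace MultiToda

section Lattice

variable {ι : Type*} [Fintype ι] [DecidableEq ι]

theorem lattice_induction {p : (ι → ℤ) → Prop} (h0 : p 0)
    (h : ∀ s i, p (s + Pi.single i 1) ↔ p s) (s : ι → ℤ) : p s := by
  have h1 : ∀ (i : ι) (n : ℤ) (s : ι → ℤ), p (s + Pi.single i n) ↔ p s := by
    intro i n
    induction n using Int.induction_on with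
    | zero => simp
    | succ n ih =>
      intro s
      rw [Pi.single_add, ← add_assoc, h, ih]
    | pred n ih =>
      intro s
      rw [← ih s, ← h _ i, add_assoc, ← Pi.single_add, sub_add_cancel]
  rw [← Finset.univ_sum_single s]
  induction (Finset.univ : Finset ι) using Finset.induction_on with
  | empty => simpa using h0
  | insert i t hi ih => rwa [Finset.sum_insert hi, add_comm, h1]

/-- A multiplicative `1`-cocycle on the lattice is a coboundary. -/
theorem exists_of_lattice_cocycle {G : Type*} [CommGroup G] (c : ι → (ι → ℤ) → G)
    (hc : ∀ i j s, c i s * c j (s + Pi.single i 1) = c j s * c i (s + Pi.single j 1)) :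
    ∃ μ : (ι → ℤ) → G, ∀ i s, μ (s + Pi.single i 1) = c i s * μ s := by
  -- Each direction acts on `ℤ^ι × G` by moving the base point and multiplying by the cocycle. The
  -- cocycle relation makes these permutations commute, so `ℤ^ι` acts, and `μ` is the second
  -- component along the orbit of `(0, 1)`.
  let P : ι → Equiv.Perm ((ι → ℤ) × G) := fun i =>
    { toFun := fun x => (x.1 + Pi.single i 1, c i x.1 * x.2)
      invFun := fun x => (x.1 - Pi.single i 1, (c i (x.1 - Pi.single i 1))⁻¹ * x.2)
      left_inv := fun x => by simp
      right_inv := fun x => by simp }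
  have hP : ∀ i j, Commute (P i) (P j) := by
    intro i j
    refine Equiv.ext fun x => Prod.ext ?_ ?_
    · exact add_right_comm _ _ _
    · change c i (x.1 + Pi.single j 1) * (c j x.1 * x.2) =
        c j (x.1 + Pi.single i 1) * (c i x.1 * x.2)
      rw [← mul_assoc, ← mul_assoc, mul_comm _ (c j x.1), ← hc, mul_comm (c i x.1)]
  let Φ : (ι → Multiplicative ℤ) →* Equiv.Perm ((ι → ℤ) × G) :=
    MonoidHom.noncommPiCoprod (fun i => zpowersHom _ (P i))
      (fun i j _ x y => ((hP i j).zpow_zpow _ _))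
  let T : (ι → ℤ) → (ι → ℤ) × G := fun s => Φ (fun i => Multiplicative.ofAdd (s i)) (0, 1)
  have hT : ∀ s i, T (s + Pi.single i 1) = P i (T s) := by
    intro s i
    have h1 : (fun k => Multiplicative.ofAdd ((s + Pi.single i 1 : ι → ℤ) k)) =
        Pi.mulSingle i (Multiplicative.ofAdd 1) * fun k => Multiplicative.ofAdd (s k) := by
      funext k
      rcases eq_or_ne k i with rfl | hk
      · simp [mul_comm]
      · simp [hk]
    have h2 : Φ (Pi.mulSingle i (Multiplicative.ofAdd 1)) = P i := by
      refine (MonoidHom.noncommPiCoprod_mulSingle _ i _).trans ?_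
      simp
    simp only [T]
    rw [h1, map_mul, h2]
    rfl
  have hT1 : ∀ s, (T s).1 = s := by
    refine lattice_induction ?_ fun s i => ?_
    · have : (fun i => Multiplicative.ofAdd ((0 : ι → ℤ) i)) = 1 := rfl
      simp only [T]
      rw [this, map_one]
      rfl
    · rw [hT]
      exact add_left_inj _
  refine ⟨fun s => (T s).2, fun i s => ?_⟩
  simp only
  rw [hT]
  change c i (T s).1 * _ = _
  rw [hT1]

end Lattice

section Tau

open Finset PowerSeries

/-- Solutions of such a linear system are determined by their constant term: a coefficient of
positive degree is a multiple of one of some `∂_v f`, which involves only lower coefficients of `f`.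
-/
theorem eq_zero_of_pderiv_eq_mul {σ : Type} {η : σ → MvPowerSeries σ ℂ} {f : MvPowerSeries σ ℂ}
    (hf : ∀ v, MvPowerSeries.pderiv ℂ v f = η v * f)
    (h0 : MvPowerSeries.constantCoeff f = 0) : f = 0 := by
  classical
  ext m
  rw [map_zero]
  induction h : m.degree using Nat.strong_induction_on generalizing m with
  | _ n ih =>
    rcases eq_or_ne m 0 with rfl | hm
    · exact h0
    · obtain ⟨v, hv⟩ := Finsupp.support_nonempty_iff.2 hm
      obtain ⟨m', rfl⟩ : ∃ m', m = m' + Finsupp.single v 1 :=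
        ⟨m - Finsupp.single v 1, (tsub_add_cancel_of_le
          (Finsupp.single_le_iff.2 (Nat.one_le_iff_ne_zero.2 (Finsupp.mem_support_iff.1 hv)))).symm⟩
      have key := congrArg (MvPowerSeries.coeff m') (hf v)
      rw [MvPowerSeries.coeff_pderiv, MvPowerSeries.coeff_mul, sum_eq_zero] at key
      · exact (mul_eq_zero.1 key).resolve_right (Nat.cast_add_one_ne_zero _)
      · intro p hp
        have hp' := congrArg Finsupp.degree (HasAntidiagonal.mem_antidiagonal.1 hp)
        simp only [map_add] at hp' h
        rw [ih _ (by simp at h; omega) p.2 rfl, mul_zero]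

variable {N : ℕ} {D : WaveData N}

/-- The logarithmic derivative of the diagonal wave function. -/
noncomputable def WaveData.logFlow (D : WaveData N) (s : Fin N → ℤ) (Γ : Dir N) :
    PowerSeries (TimeFun N) := D.diagAdj s Γ * flow (dT ℂ Γ) (D.diagWav s Γ)

/-- The logarithmic derivatives of the tau function. -/
noncomputable def WaveData.logDeriv (D : WaveData N) (s : Fin N → ℤ) : TimeVar N → TimeFun N
  | Sum.inl v => -coeff (v.2 : ℕ) (D.logFlow s (Sum.inl v.1))
  | Sum.inr v => -coeff (v.2 : ℕ) (D.logFlow s (Sum.inr v.1))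

theorem WaveData.logDeriv_timeVar (D : WaveData N) (s : Fin N → ℤ) (Γ : Dir N) (k : ℕ) :
    D.logDeriv s (timeVar Γ k) = -coeff (k + 1) (D.logFlow s Γ) := by
  rcases Γ with γ | γ <;> rfl

theorem WaveData.coeff_zero_logFlow (D : WaveData N) (s : Fin N → ℤ) (Γ : Dir N) :
    coeff 0 (D.logFlow s Γ) = 0 := by
  rw [logFlow, coeff_zero_mul, coeff_zero_flow, mul_zero]

theorem BilinearIdentity.flow_diagWav (hD : BilinearIdentity D) (s : Fin N → ℤ) (Γ : Dir N) :
    flow (dT ℂ Γ) (D.diagWav s Γ) = D.logFlow s Γ * D.diagWav s Γ := by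
  rw [WaveData.logFlow]
  linear_combination -flow (dT ℂ Γ) (D.diagWav s Γ) * hD.diagWav_mul_diagAdj s Γ

theorem BilinearIdentity.extD_diagWav (hD : BilinearIdentity D) (s : Fin N → ℤ) (Γ Γ' : Dir N)
    (k : ℕ) : extD (dT ℂ Γ k) (D.diagWav s Γ') = (C (coeff (k + 1) (D.logFlow s Γ)) -
      miwa (dT ℂ Γ') (coeff (k + 1) (D.logFlow (s + dirShift Γ') Γ))) * D.diagWav s Γ' :=
  extD_pad_of_cocycle (fun k l f => dT_comm ℂ Γ Γ' k l f) (hD.flow_diagWav s Γ)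
    (hD.flow_diagWav _ Γ) (hD.isUnit_diagWav _ _) (hD.cocycle s Γ Γ') (k + 1)

/-- The integrability condition for `∂_v log τ = logDeriv s v`. The minus sign in `logDeriv` is
forced by `flow log (τ(t - [a]) / τ(t)) = -∑ a^k ∂_k log τ`. -/
theorem BilinearIdentity.pderiv_logDeriv (hD : BilinearIdentity D) (s : Fin N → ℤ)
    (u v : TimeVar N) : MvPowerSeries.pderiv ℂ u (D.logDeriv s v) =
      MvPowerSeries.pderiv ℂ v (D.logDeriv s u) := by
  obtain ⟨Γ, k, rfl⟩ := exists_timeVar u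
  obtain ⟨Γ', l, rfl⟩ := exists_timeVar v
  rw [D.logDeriv_timeVar, D.logDeriv_timeVar, map_neg, map_neg]
  exact congrArg Neg.neg (pad_coeff_eq_of_extD (fun l f => dT_comm ℂ Γ Γ' k l f)
    (hD.flow_diagWav s Γ') (hD.isUnit_diagWav _ _) (hD.extD_diagWav s Γ Γ' k) (l + 1))

theorem BilinearIdentity.pderiv_coeff_zero_diagWav (hD : BilinearIdentity D) (s : Fin N → ℤ)
    (Γ : Dir N) (v : TimeVar N) :
    MvPowerSeries.pderiv ℂ v (coeff 0 (D.diagWav s Γ)) =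
      (D.logDeriv (s + dirShift Γ) v - D.logDeriv s v) * coeff 0 (D.diagWav s Γ) := by
  obtain ⟨Γ', k, rfl⟩ := exists_timeVar v
  have h := congrArg (coeff 0) (hD.extD_diagWav s Γ' Γ k)
  rw [coeff_extD, coeff_zero_mul, map_sub, coeff_miwa, dschur_zero, coeff_C, if_pos rfl] at h
  rw [D.logDeriv_timeVar, D.logDeriv_timeVar]
  refine h.trans ?_
  ring

theorem BilinearIdentity.coeff_zero_cocycle (hD : BilinearIdentity D) (s : Fin N → ℤ)
    (Γ Γ' : Dir N) :
    coeff 0 (D.diagWav s Γ) * coeff 0 (D.diagWav (s + dirShift Γ) Γ') =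
      coeff 0 (D.diagWav s Γ') * coeff 0 (D.diagWav (s + dirShift Γ') Γ) := by
  have h := congrArg (fun F => coeff 0 (coeff 0 F)) (hD.cocycle s Γ Γ')
  simpa only [coeff_zero_mul, coeff_map, coeff_C, if_true, coeff_miwa, dschur_zero] using h

/-- The diagonal entry of the tau function. -/
theorem BilinearIdentity.exists_tau (hD : BilinearIdentity D) :
    ∃ τ : (Fin N → ℤ) → TimeFun N, (∀ s, MvPowerSeries.constantCoeff (τ s) ≠ 0) ∧
      ∀ s Γ, D.diagWav s Γ * C (τ s) = miwa (dT ℂ Γ) (τ (s + dirShift Γ)) := by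
  choose τ' h0 hτ' using fun s => exists_pderiv_eq_mul (hD.pderiv_logDeriv s)
  have hu : ∀ s Γ, IsUnit (MvPowerSeries.constantCoeff (coeff 0 (D.diagWav s Γ))) := by
    intro s Γ
    have := (hD.isUnit_diagWav s Γ).map
      ((MvPowerSeries.constantCoeff (σ := TimeVar N) (R := ℂ)).comp constantCoeff)
    simpa using this
  -- Only barred families move `s`. The `τ' s` have constant term one, so the rescaling needed is
  -- given by the constant terms of the leading coefficients of the barred diagonal wave functions.
  obtain ⟨μ, hμ⟩ := exists_of_lattice_cocycle (fun γ s => (hu s (Sum.inr γ)).unit)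
    (fun i j s => Units.ext (by
      have := congrArg MvPowerSeries.constantCoeff
        (hD.coeff_zero_cocycle s (Sum.inr i) (Sum.inr j))
      rw [map_mul, map_mul] at this
      exact this))
  refine ⟨fun s => MvPowerSeries.C (μ s : ℂ) * τ' s, fun s => by simp [h0], fun s Γ => ?_⟩
  have hd : ∀ s v, MvPowerSeries.pderiv ℂ v (MvPowerSeries.C (μ s : ℂ) * τ' s) =
      D.logDeriv s v * (MvPowerSeries.C (μ s : ℂ) * τ' s) := by
    intro s v
    rw [← pd_apply, pd_mul, pd_C, pd_apply, hτ']
    ring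
  have hC : flow (dT ℂ Γ) (C (MvPowerSeries.C (μ s : ℂ) * τ' s)) =
      -D.logFlow s Γ * C (MvPowerSeries.C (μ s : ℂ) * τ' s) := by
    ext1 n
    rw [coeff_flow_C, coeff_mul_C, map_neg]
    rcases n with _ | n
    · simp [pad, D.coeff_zero_logFlow]
    · rw [← D.logDeriv_timeVar]
      exact hd s (timeVar Γ n)
  -- A series killed by `flow` is the shift of its value at `a = 0`: the logarithmic flows of
  -- `diagWav` and of `τ` cancel, and the value at `a = 0` must be `τ (s + dirShift Γ)`.
  refine (eq_mk_dschur (d := dT ℂ Γ) ?_ ?_)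
  · rw [Derivation.leibniz, hC, hD.flow_diagWav, smul_eq_mul, smul_eq_mul]
    ring
  · rw [coeff_mul_C]
    rcases Γ with γ | γ
    · have : coeff 0 (D.diagWav s (Sum.inl γ)) = 1 := by
        rw [WaveData.diagWav, D.coeff_zero_wav]
        exact if_pos rfl
      rw [this, one_mul]
      simp [dirShift]
    · rw [← sub_eq_zero]
      -- Both sides satisfy the same linear system, and `μ` was chosen to match their constant
      -- terms.
      refine eq_zero_of_pderiv_eq_mul (η := D.logDeriv (s + dirShift (Sum.inr γ))) (fun v => ?_) ?_
      · rw [map_sub, hd, ← pd_apply, pd_mul, pd_apply, pd_apply, hd,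
          hD.pderiv_coeff_zero_diagWav]
        ring
      · simp [h0, dirShift, hμ]

end Tau

end MultiToda

/-! ### The shift operators as substitutions. -/

namespace MultiToda

section Substitution

open Finset PowerSeries

theorem miwa_eq_add {A : Type*} [CommRing A] [Algebra ℂ A] {d : ℕ → Derivation ℂ A A} {x : A}
    {c : ℂ} {j : ℕ} (hj : j ≠ 0)
    (h : ∀ k, d k x = if k + 1 = j then algebraMap ℂ A (-(j * c)) else 0) :
    miwa d x = C x + C (algebraMap ℂ A c) * X ^ j := by
  refine (eq_mk_dschur (d := d) ?_ ?_).symm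
  · ext1 n
    rw [map_add, map_add, coeff_flow_C, coeff_flow]
    simp only [coeff_C_mul, coeff_X_pow, map_zero]
    rw [sum_eq_zero, add_zero]
    · rcases n with _ | n
      · simp [pad]
      · simp only [pad, h]
        split_ifs with hn
        · subst hn
          rw [mul_one, Algebra.smul_def, ← map_mul, ← map_add]
          simp
        · simp
    · rintro ⟨i, k⟩ -
      rcases i with _ | i
      · simp [pad]
      · simp only [pad]
        split_ifs <;> simp
  · simp [hj]

variable {σ τ : Type}

/-- The hypotheses `h` and `h'` express continuity: each output coefficient depends on finitely many
input coefficients. Hence `f` may be replaced by a polynomial, on which constants and variables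
decide. -/
theorem ringHom_ext_of_finite {Φ Φ' : MvPowerSeries σ ℂ →+* PowerSeries (MvPowerSeries τ ℂ)}
    (h : ∀ n m, ∃ S : Finset (σ →₀ ℕ), ∀ f, (∀ d ∈ S, MvPowerSeries.coeff d f = 0) →
      MvPowerSeries.coeff m (coeff n (Φ f)) = 0)
    (h' : ∀ n m, ∃ S : Finset (σ →₀ ℕ), ∀ f, (∀ d ∈ S, MvPowerSeries.coeff d f = 0) →
      MvPowerSeries.coeff m (coeff n (Φ' f)) = 0)
    (hC : ∀ c, Φ (MvPowerSeries.C c) = Φ' (MvPowerSeries.C c))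
    (hX : ∀ v, Φ (MvPowerSeries.X v) = Φ' (MvPowerSeries.X v)) : Φ = Φ' := by
  classical
  have hp : Φ.comp MvPolynomial.coeToMvPowerSeries.ringHom =
      Φ'.comp MvPolynomial.coeToMvPowerSeries.ringHom := by
    refine MvPolynomial.ringHom_ext (fun c => ?_) fun v => ?_
    · simpa using hC c
    · simpa using hX v
  refine RingHom.ext fun f => ?_
  ext1 n
  ext1 m
  obtain ⟨S, hS⟩ := h n m
  obtain ⟨S', hS'⟩ := h' n m
  set p : MvPolynomial σ ℂ :=
    ∑ d ∈ S ∪ S', MvPolynomial.monomial d (MvPowerSeries.coeff d f) with hpdef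
  have hfp : ∀ d ∈ S ∪ S', MvPowerSeries.coeff d (f - (p : MvPowerSeries σ ℂ)) = 0 := by
    intro d hd
    rw [map_sub, MvPolynomial.coeff_coe, hpdef, MvPolynomial.coeff_sum]
    simp only [MvPolynomial.coeff_monomial, sum_ite_eq', hd, if_true, sub_self]
  have h1 := hS _ fun d hd => hfp d (mem_union_left _ hd)
  have h2 := hS' _ fun d hd => hfp d (mem_union_right _ hd)
  have h3 := RingHom.congr_fun hp p
  change Φ (p : MvPowerSeries σ ℂ) = Φ' (p : MvPowerSeries σ ℂ) at h3
  rw [map_sub, map_sub, map_sub, sub_eq_zero] at h1 h2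
  rw [h1, h2, h3]

theorem exists_finset_dschur
    {d : ℕ → Derivation ℂ (MvPowerSeries σ ℂ) (MvPowerSeries σ ℂ)}
    (hd : ∀ k m, ∃ S : Finset (σ →₀ ℕ), ∀ f, (∀ e ∈ S, MvPowerSeries.coeff e f = 0) →
      MvPowerSeries.coeff m (d k f) = 0) (n : ℕ) (m : σ →₀ ℕ) :
    ∃ S : Finset (σ →₀ ℕ), ∀ f, (∀ e ∈ S, MvPowerSeries.coeff e f = 0) →
      MvPowerSeries.coeff m (dschur d n f) = 0 := by
  classical
  induction n using Nat.strong_induction_on generalizing m with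
  | _ n ih =>
    rcases eq_or_ne n 0 with rfl | hn
    · exact ⟨{m}, fun f hf => by simpa using hf m (mem_singleton_self m)⟩
    · have key : ∀ p ∈ antidiagonal n, ∃ S : Finset (σ →₀ ℕ), ∀ f,
          (∀ e ∈ S, MvPowerSeries.coeff e f = 0) →
            MvPowerSeries.coeff m (pad d p.1 (dschur d p.2 f)) = 0 := by
        rintro ⟨i, k⟩ hp
        rw [HasAntidiagonal.mem_antidiagonal] at hp
        rcases i with _ | i
        · exact ⟨∅, fun f _ => by simp [pad]⟩
        · obtain ⟨S, hS⟩ := hd i m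
          choose T hT using ih k (by simp at hp; omega)
          refine ⟨S.biUnion T, fun f hf => hS _ fun e he => hT e f fun e' he' => ?_⟩
          exact hf e' (mem_biUnion.2 ⟨e, he, he'⟩)
      choose! T hT using key
      refine ⟨(antidiagonal n).biUnion T, fun f hf => ?_⟩
      have h := congrArg (MvPowerSeries.coeff m) (smul_dschur d n f)
      rw [map_neg, map_sum, sum_eq_zero, neg_zero] at h
      · exact (smul_eq_zero_iff_right (Nat.cast_ne_zero.2 hn : (n : ℂ) ≠ 0)).1 h
      · intro p hp
        exact hT p hp f fun e he => hf e (mem_biUnion.2 ⟨p, hp, he⟩)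

theorem exists_finset_subst {a : σ → MvPowerSeries τ ℂ} (ha : MvPowerSeries.HasSubst a)
    (m : τ →₀ ℕ) : ∃ S : Finset (σ →₀ ℕ), ∀ f : MvPowerSeries σ ℂ,
      (∀ e ∈ S, MvPowerSeries.coeff e f = 0) → MvPowerSeries.coeff m (f.subst a) = 0 := by
  have h : (Function.support fun d : σ →₀ ℕ =>
      MvPowerSeries.coeff m (d.prod fun s e => a s ^ e)).Finite := by
    have := MvPowerSeries.coeff_subst_finite ha (fun _ => 1 : MvPowerSeries σ ℂ) m
    refine Set.Finite.subset this fun d hd => ?_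
    rw [Function.mem_support] at hd ⊢
    change (1 : ℂ) • _ ≠ 0
    rwa [one_smul]
  refine ⟨h.toFinset, fun f hf => ?_⟩
  rw [MvPowerSeries.coeff_subst ha, finsum_eq_zero_of_forall_eq_zero]
  intro d
  by_cases hd : MvPowerSeries.coeff m (d.prod fun s e => a s ^ e) = 0
  · rw [hd, smul_zero]
  · rw [hf d (by simpa using hd), zero_smul]

theorem collectZ_eq_toZ (f : MvPowerSeries (Option σ) ℂ) :
    collectZ f = toZ (MvPowerSeries.optionEquivLeft σ ℂ f) := by
  classical
  refine (sumNegPow_eq_toZ _).trans ?_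
  congr 1
  ext1 j
  ext1 m
  refine (congrArg (MvPowerSeries.coeff m) (coeff_mk j _)).trans ?_
  rw [MvPowerSeries.coeff_coeff_optionEquivLeft]
  refine congrArg (fun e => MvPowerSeries.coeff e f) (Finsupp.ext fun o => ?_)
  rcases o with _ | a
  · simp [Finsupp.mapDomain_of_notMem_range]
  · simp [Finsupp.mapDomain_apply (Option.some_injective σ)]

/-- Substitution and `miwa d` are continuous ring homomorphisms over `ℂ`, so it suffices to compare
them on the variables. -/
theorem collectZ_subst_eq {a : σ → MvPowerSeries (Option σ) ℂ} (ha : MvPowerSeries.HasSubst a)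
    {d : ℕ → Derivation ℂ (MvPowerSeries σ ℂ) (MvPowerSeries σ ℂ)}
    (hd : ∀ k m, ∃ S : Finset (σ →₀ ℕ), ∀ f, (∀ e ∈ S, MvPowerSeries.coeff e f = 0) →
      MvPowerSeries.coeff m (d k f) = 0)
    (hX : ∀ v, MvPowerSeries.optionEquivLeft σ ℂ (a v) = miwa d (MvPowerSeries.X v))
    (f : MvPowerSeries σ ℂ) : collectZ (f.subst a) = toZ (miwa d f) := by
  rw [collectZ_eq_toZ]
  congr 1
  let Φ : MvPowerSeries σ ℂ →+* PowerSeries (MvPowerSeries σ ℂ) :=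
    ((MvPowerSeries.optionEquivLeft σ ℂ).toAlgHom.comp
      (MvPowerSeries.substAlgHom (R := ℂ) ha)).toRingHom
  have hΦ : ∀ f, Φ f = MvPowerSeries.optionEquivLeft σ ℂ (f.subst a) := by
    intro f
    rw [← MvPowerSeries.coe_substAlgHom ha]
    rfl
  have key : Φ = miwa d := by
    refine ringHom_ext_of_finite (fun n m => ?_) (fun n m => ?_) (fun c => ?_) fun v => ?_
    · obtain ⟨S, hS⟩ := exists_finset_subst ha (m.optionElim n)
      refine ⟨S, fun f hf => ?_⟩
      rw [hΦ, MvPowerSeries.coeff_coeff_optionEquivLeft]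
      exact hS f hf
    · simp only [coeff_miwa]
      exact exists_finset_dschur hd n m
    · have h1 : Φ (MvPowerSeries.C c) = C (MvPowerSeries.C c) :=
        (((MvPowerSeries.optionEquivLeft σ ℂ).toAlgHom.comp
          (MvPowerSeries.substAlgHom (R := ℂ) ha)).commutes c).trans algebraMap_apply
      rw [h1]
      ext1 n
      have hdc : ∀ k, d k (MvPowerSeries.C c) = 0 := fun k => (d k).map_algebraMap c
      rw [coeff_miwa]
      rcases eq_or_ne n 0 with rfl | hn
      · rw [dschur_zero, coeff_C, if_pos rfl]
      · rw [dschur_eq_zero hdc hn, coeff_C, if_neg hn]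
    · rw [hΦ, MvPowerSeries.subst_X ha, hX]
  rw [← hΦ, key]

theorem pderiv_X_self (v : σ) : MvPowerSeries.pderiv ℂ v (MvPowerSeries.X v) = 1 := by
  rw [← MvPolynomial.coe_X, MvPowerSeries.pderiv_coe]
  simp

theorem pderiv_X_of_ne {u v : σ} (h : v ≠ u) :
    MvPowerSeries.pderiv ℂ u (MvPowerSeries.X v) = 0 := by
  rw [← MvPolynomial.coe_X, MvPowerSeries.pderiv_coe, MvPolynomial.pderiv_X_of_ne h]
  simp

theorem exists_finset_of_eq_smul_pderiv {u : ℕ → σ} {c : ℂ}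
    {d : ℕ → Derivation ℂ (MvPowerSeries σ ℂ) (MvPowerSeries σ ℂ)}
    (hd : ∀ k f, d k f = c • MvPowerSeries.pderiv ℂ (u k) f) (k : ℕ) (m : σ →₀ ℕ) :
    ∃ S : Finset (σ →₀ ℕ), ∀ f, (∀ e ∈ S, MvPowerSeries.coeff e f = 0) →
      MvPowerSeries.coeff m (d k f) = 0 := by
  refine ⟨{m + Finsupp.single (u k) 1}, fun f hf => ?_⟩
  rw [hd]
  change c • MvPowerSeries.coeff m (MvPowerSeries.pderiv ℂ (u k) f) = 0
  rw [MvPowerSeries.coeff_pderiv, hf _ (mem_singleton_self _), zero_mul, smul_zero]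

theorem miwa_X_self {u : ℕ → σ} (hu : Function.Injective u) {ε : ℂ}
    {d : ℕ → Derivation ℂ (MvPowerSeries σ ℂ) (MvPowerSeries σ ℂ)}
    (hd : ∀ k f, d k f = (-ε) • MvPowerSeries.pderiv ℂ (u k) f) (k : ℕ) :
    miwa d (MvPowerSeries.X (u k)) = C (MvPowerSeries.X (u k)) +
      C (MvPowerSeries.C (ε / ((k + 1 : ℕ) : ℂ))) * X ^ (k + 1) := by
  refine (miwa_eq_add (c := ε / ((k + 1 : ℕ) : ℂ)) (Nat.succ_ne_zero k) fun l => ?_).trans rfl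
  rw [hd]
  split_ifs with h
  · obtain rfl : l = k := by omega
    rw [pderiv_X_self, Algebra.algebraMap_eq_smul_one, mul_div_cancel₀]
    exact Nat.cast_ne_zero.2 (Nat.succ_ne_zero l)
  · rw [pderiv_X_of_ne (fun hk => h (by rw [hu hk])), smul_zero]

theorem miwa_X_of_ne {u : ℕ → σ} {v : σ} (hv : ∀ k, v ≠ u k) {ε : ℂ}
    {d : ℕ → Derivation ℂ (MvPowerSeries σ ℂ) (MvPowerSeries σ ℂ)}
    (hd : ∀ k f, d k f = (-ε) • MvPowerSeries.pderiv ℂ (u k) f) :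
    miwa d (MvPowerSeries.X v) = C (MvPowerSeries.X v) := by
  ext1 n
  rw [coeff_miwa, coeff_C]
  split_ifs with hn
  · rw [hn, dschur_zero]
  · exact dschur_eq_zero (fun k => by rw [hd, pderiv_X_of_ne (hv k), smul_zero]) hn

variable {N : ℕ}

theorem timeVar_injective (Γ : Dir N) : Function.Injective (timeVar Γ) := by
  intro k l h
  rcases Γ with γ | γ <;> simpa [timeVar] using h

theorem miwaT_eq (ε : ℂ) (γ : Fin N)
    {d : ℕ → Derivation ℂ (TimeFun N) (TimeFun N)}
    (hd : ∀ k f, d k f = (-ε) • dT ℂ (Sum.inl γ) k f) (f : TimeFun N) :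
    miwaT ε γ f = toZ (miwa d f) := by
  refine collectZ_subst_eq (hasSubst_shiftT ε γ) (exists_finset_of_eq_smul_pderiv hd)
    (fun v => ?_) f
  rcases v with ⟨α, j⟩ | v
  · by_cases h : α = γ
    · subst h
      have := miwa_X_self (timeVar_injective (Sum.inl α)) hd j.natPred
      simp only [timeVar, PNat.succPNat_natPred, PNat.natPred_add_one] at this
      rw [this, shiftT, if_pos rfl]
      simp
    · rw [shiftT, if_neg h, add_zero, MvPowerSeries.optionEquivLeft_X_some]
      refine (miwa_X_of_ne (fun k hk => h ?_) hd).symm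
      simp only [timeVar, Sum.inl.injEq, Prod.mk.injEq] at hk
      exact hk.1
  · rw [shiftT, MvPowerSeries.optionEquivLeft_X_some]
    exact (miwa_X_of_ne (fun k hk => by simp [timeVar] at hk) hd).symm

theorem miwaTbar_eq (ε : ℂ) (γ : Fin N)
    {d : ℕ → Derivation ℂ (TimeFun N) (TimeFun N)}
    (hd : ∀ k f, d k f = (-ε) • dT ℂ (Sum.inr γ) k f) (f : TimeFun N) :
    miwaTbar ε γ f = toZ (miwa d f) := by
  refine collectZ_subst_eq (hasSubst_shiftTbar ε γ) (exists_finset_of_eq_smul_pderiv hd)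
    (fun v => ?_) f
  rcases v with v | ⟨α, j⟩
  · rw [shiftTbar, MvPowerSeries.optionEquivLeft_X_some]
    exact (miwa_X_of_ne (fun k hk => by simp [timeVar] at hk) hd).symm
  · by_cases h : α = γ
    · subst h
      have := miwa_X_self (timeVar_injective (Sum.inr α)) hd j.natPred
      simp only [timeVar, PNat.succPNat_natPred, PNat.natPred_add_one] at this
      rw [this, shiftTbar, if_pos rfl]
      simp
    · rw [shiftTbar, if_neg h, add_zero, MvPowerSeries.optionEquivLeft_X_some]
      refine (miwa_X_of_ne (fun k hk => h ?_) hd).symm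
      simp only [timeVar, Sum.inr.injEq, Prod.mk.injEq] at hk
      exact hk.1

theorem miwaT_neg_one (γ : Fin N) (f : TimeFun N) :
    miwaT (-1) γ f = toZ (miwa (dT ℂ (Sum.inl γ)) f) :=
  miwaT_eq _ _ (fun k f => by simp) f

theorem miwaT_one (γ : Fin N) (f : TimeFun N) :
    miwaT 1 γ f = toZ (miwa (-dT ℂ (Sum.inl γ)) f) :=
  miwaT_eq _ _ (fun k f => by simp) f

theorem miwaTbar_neg_one (γ : Fin N) (f : TimeFun N) :
    miwaTbar (-1) γ f = toZ (miwa (dT ℂ (Sum.inr γ)) f) :=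
  miwaTbar_eq _ _ (fun k f => by simp) f

theorem miwaTbar_one (γ : Fin N) (f : TimeFun N) :
    miwaTbar 1 γ f = toZ (miwa (-dT ℂ (Sum.inr γ)) f) :=
  miwaTbar_eq _ _ (fun k f => by simp) f

end Substitution

end MultiToda

/-! ### The tau matrix and the four wave function formulas. -/

namespace MultiToda

section TauMatrix

open PowerSeries

variable {N : ℕ} {D : WaveData N}

/-- The matrix of tau functions with diagonal `τ`. -/
noncomputable def WaveData.tauMat (D : WaveData N) (τ : (Fin N → ℤ) → TimeFun N)
    (s : Fin N → ℤ) : Matrix (Fin N) (Fin N) (TimeFun N) :=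
  fun α β => if α = β then τ s else D.w s 1 α β * τ s

variable {τ : (Fin N → ℤ) → TimeFun N}

theorem BilinearIdentity.wav_mul_tau (hD : BilinearIdentity D)
    (hτ : ∀ s Γ, D.diagWav s Γ * C (τ s) = miwa (dT ℂ Γ) (τ (s + dirShift Γ)))
    (s : Fin N → ℤ) (i : Fin N) (Γ : Dir N) :
    D.wav s i Γ * C (τ s) = (if i = Γ.comp then 1 else dirCoef Γ) *
      miwa (dT ℂ Γ) (D.tauMat τ (s + dirShift Γ) i Γ.comp) := by
  rw [WaveData.tauMat]
  split_ifs with h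
  · subst h
    rw [one_mul]
    exact hτ s Γ
  · rw [hD.wav_eq s h, mul_assoc, hτ, map_mul, mul_assoc]

theorem miwaExt_dirCoef (d : ℕ → Derivation ℂ (TimeFun N) (TimeFun N)) (Γ : Dir N) :
    miwaExt d (dirCoef Γ) = dirCoef Γ := by
  rcases Γ with γ | γ
  · exact miwaExt_X d
  · simp [dirCoef]

theorem BilinearIdentity.adj_mul_tau (hD : BilinearIdentity D)
    (hτ : ∀ s Γ, D.diagWav s Γ * C (τ s) = miwa (dT ℂ Γ) (τ (s + dirShift Γ)))
    (s : Fin N → ℤ) (Γ : Dir N) (j : Fin N) :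
    D.adj (s + dirShift Γ) Γ j * C (τ (s + dirShift Γ)) =
      (if Γ.comp = j then 1 else -dirCoef Γ) * miwa (-dT ℂ Γ) (D.tauMat τ s Γ.comp j) := by
  have hcomm : ∀ k l f, dT ℂ Γ k (dT ℂ Γ l f) = dT ℂ Γ l (dT ℂ Γ k f) :=
    fun k l f => dT_comm ℂ Γ Γ k l f
  -- After the shift the product is known from `diagWav_mul_diagAdj` and `diagWav_mul_adj`, since `τ
  -- (s + dirShift Γ)` shifted is `diagWav s Γ * C (τ s)`. Shifting back by `miwaExt` of `-dT ℂ Γ`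
  -- turns `t - [a]` into `t + [a]`.
  have key : miwaExt (dT ℂ Γ) (D.adj (s + dirShift Γ) Γ j * C (τ (s + dirShift Γ))) =
      (if Γ.comp = j then 1 else -dirCoef Γ) * C (D.tauMat τ s Γ.comp j) := by
    rw [map_mul, miwaExt_C, ← hτ, WaveData.tauMat]
    split_ifs with h
    · subst h
      have h1 := hD.diagWav_mul_diagAdj s Γ
      rw [WaveData.diagAdj] at h1
      linear_combination C (τ s) * h1
    · have h1 := hD.diagWav_mul_adj s (Ne.symm h)
      rw [map_mul]
      linear_combination C (τ s) * h1
  rw [← miwaExt_neg_miwaExt hcomm (D.adj (s + dirShift Γ) Γ j * C (τ (s + dirShift Γ))), key,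
    map_mul, miwaExt_C]
  split_ifs
  · rw [map_one]
  · rw [map_neg, miwaExt_dirCoef]

theorem sgn_eq (α β : Fin N) : sgn α β = if α = β then 1 else -1 := by
  rw [sgn, delta]
  split_ifs
  · simp [constZ]
  · simp [constZ, zpow_neg]

theorem constZ_mul_inv {f : TimeFun N} (hf : MvPowerSeries.constantCoeff f ≠ 0) :
    constZ f * (constZ f)⁻¹ = 1 := by
  refine MvPowerSeries.mul_inv_cancel _ ?_
  rw [constZ, MvPowerSeries.constantCoeff_map]
  simpa using hf

theorem toZ_eq_of_mul_C_eq {F G : PowerSeries (TimeFun N)} {f : TimeFun N}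
    (hf : MvPowerSeries.constantCoeff f ≠ 0) (h : F * C f = G) :
    toZ F = toZ G * (constZ f)⁻¹ := by
  rw [← h, map_mul, toZ_C, mul_assoc, constZ_mul_inv hf, mul_one]

theorem toZ_ite_X (p : Prop) [Decidable p] :
    toZ (if p then 1 else X : PowerSeries (TimeFun N)) = zPow ((if p then 1 else 0) - 1) := by
  split_ifs
  · simp
  · rw [toZ_X, zero_sub]

theorem toZ_ite_neg_X (α β : Fin N) :
    toZ (if α = β then 1 else -X : PowerSeries (TimeFun N)) =
      sgn α β * zPow (delta α β - 1) := by
  rw [sgn_eq, delta, ← toZ_ite_X]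
  split_ifs
  · rw [map_one, mul_one]
  · rw [map_neg]
    ring

end TauMatrix

end MultiToda

theorem mainTheorem1 (N : ℕ) (D : MultiToda.WaveData N) (hD : MultiToda.BilinearIdentity D) :
    ∃ (τmat : (Fin N → ℤ) → Matrix (Fin N) (Fin N) (MultiToda.TimeFun N))
      (τ : (Fin N → ℤ) → MultiToda.TimeFun N),
      (∀ s, IsUnit (τ s)) ∧
      (∀ s α, τmat s α α = τ s) ∧
      ∀ (s : Fin N → ℤ) (α β : Fin N),
        D.Psi s α β =
            MultiToda.zPow (s β + MultiToda.delta α β - 1) *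
              MultiToda.expZ (MultiToda.xiT β) *
              (MultiToda.miwaT (-1) β (τmat s α β) * (MultiToda.constZ (τ s))⁻¹) ∧
        D.PsiStar s α β =
            MultiToda.sgn α β *
              MultiToda.zPow (-s α + MultiToda.delta α β - 1) *
              MultiToda.expZ (-MultiToda.xiT α) *
              (MultiToda.miwaT 1 α (τmat s α β) * (MultiToda.constZ (τ s))⁻¹) ∧
        D.PsiBarInv s α β =
            MultiToda.sgn α β * MultiToda.zPow (-s β) *
              MultiToda.expZ (MultiToda.xiTbar β) *
              (MultiToda.miwaTbar (-1) β (τmat (s + Pi.single β 1) α β) *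
                (MultiToda.constZ (τ s))⁻¹) ∧
        D.PsiBarStarInv s α β =
            MultiToda.zPow (s α) *
              MultiToda.expZ (-MultiToda.xiTbar α) *
              (MultiToda.miwaTbar 1 α (τmat (s - Pi.single α 1) α β) *
                (MultiToda.constZ (τ s))⁻¹) := by
  obtain ⟨τ, hτ0, hτ⟩ := hD.exists_tau
  have hadd : ∀ (s : Fin N → ℤ) γ, s + MultiToda.dirShift (Sum.inl γ) = s := fun s γ => add_zero s
  refine ⟨D.tauMat τ, τ, fun s => ?_, fun s α => if_pos rfl, fun s α β => ⟨?_, ?_, ?_, ?_⟩⟩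
  · rw [MvPowerSeries.isUnit_iff_constantCoeff]
    exact (hτ0 s).isUnit
  · have h := MultiToda.toZ_eq_of_mul_C_eq (hτ0 s) (hD.wav_mul_tau hτ s α (Sum.inl β))
    rw [hadd, map_mul] at h
    change MultiToda.toZ _ = MultiToda.toZ (if α = β then 1 else PowerSeries.X) *
      MultiToda.toZ (MultiToda.miwa _ (D.tauMat τ s α β)) * _ at h
    rw [MultiToda.toZ_ite_X, ← MultiToda.miwaT_neg_one] at h
    rw [add_sub_assoc, MultiToda.zPow_add, MultiToda.WaveData.Psi, MultiToda.sumNegPow_eq_toZ]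
    change MultiToda.toZ (D.wav s α (Sum.inl β)) * _ * _ = _
    rw [h, MultiToda.delta]
    ring
  · have h := MultiToda.toZ_eq_of_mul_C_eq (hτ0 _) (hD.adj_mul_tau hτ s (Sum.inl α) β)
    rw [hadd, map_mul] at h
    change MultiToda.toZ _ = MultiToda.toZ (if α = β then 1 else -PowerSeries.X) *
      MultiToda.toZ (MultiToda.miwa _ (D.tauMat τ s α β)) * _ at h
    rw [MultiToda.toZ_ite_neg_X, ← MultiToda.miwaT_one] at h
    rw [add_sub_assoc, MultiToda.zPow_add, MultiToda.WaveData.PsiStar,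
      MultiToda.sumNegPow_eq_toZ]
    change MultiToda.toZ (D.adj s (Sum.inl α) β) * _ * _ = _
    rw [h]
    ring
  · have h := MultiToda.toZ_eq_of_mul_C_eq (hτ0 s) (hD.wav_mul_tau hτ s α (Sum.inr β))
    rw [map_mul] at h
    have h1 : MultiToda.toZ (if α = β then 1 else -1) = MultiToda.sgn α β := by
      rw [MultiToda.sgn_eq]
      split_ifs <;> simp
    change MultiToda.toZ _ = MultiToda.toZ (if α = β then 1 else -1) *
      MultiToda.toZ (MultiToda.miwa _ (D.tauMat τ (s + Pi.single β 1) α β)) * _ at h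
    rw [h1, ← MultiToda.miwaTbar_neg_one] at h
    rw [MultiToda.WaveData.PsiBarInv, MultiToda.sumNegPow_eq_toZ]
    change MultiToda.toZ (D.wav s α (Sum.inr β)) * _ * _ = _
    rw [h]
    ring
  -- The adjoint formula lives at `s + dirShift Γ`, so it is applied at `s` lowered by one in `α`.
  -- The factor `-dirCoef` is `1` for barred families, hence no sign.
  · have hs : s - Pi.single α 1 + MultiToda.dirShift (Sum.inr α) = s := sub_add_cancel _ _
    have h := MultiToda.toZ_eq_of_mul_C_eq (hτ0 _)
      (hD.adj_mul_tau hτ (s - Pi.single α 1) (Sum.inr α) β)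
    rw [hs, map_mul] at h
    change MultiToda.toZ _ = MultiToda.toZ (if α = β then 1 else - -1) *
      MultiToda.toZ (MultiToda.miwa _ (D.tauMat τ (s - Pi.single α 1) α β)) * _ at h
    rw [neg_neg, ite_self, map_one, one_mul, ← MultiToda.miwaTbar_one] at h
    rw [MultiToda.WaveData.PsiBarStarInv, MultiToda.sumNegPow_eq_toZ]
    change MultiToda.toZ (D.adj s (Sum.inr α) β) * _ * _ = _
    rw [h]
    ring
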